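/- **Theorem (a sufficient condition for overlap).** Notation. Let $m,n\ge 1$, $A\in\mathbb{C}^{m\times m}$, $B\in\mathbb{C}^{n\times n}$, $z_0\in\mathbb{C}$; $\|\cdot\|$ is the spectral norm, $\Lambda$ the spectrum, $\mu$ Lebesgue measure. For $\varepsilon\ge 0$ let $\Lambda_\varepsilon(A)=\{z : z\in\Lambda(A+\Delta)\text{ for some }\|\Delta\|\le\varepsilon\}$, and let $$\mathrm{sep}_\lambda^{\mathrm D}(A,B)=\min\{\varepsilon : \Lambda(A+E)\cap\Lambda(B+F)\neq\varnothing \text{ for some } E,F \text{ with } \max(\|E\|,\|F\|)\le\varepsilon\}.$$ For $\theta\in\mathbb{R}$ let $\mathcal R_{z_0}(\theta)=\{z_0+re^{\mathbf i\theta}: r>0\}$, $F_A(r,\theta)=A-(z_0+re^{\mathbf i\theta})I$, $$C=\begin{bmatrix}A-z_0I&-\varepsilon I\\ \varepsilon I&-(A-z_0I)^*\end{bmatrix},\qquad D_\theta=\begin{bmatrix}-\mathbf i e^{\mathbf i\theta}I&0\\0&\mathbf i e^{-\mathbf i\theta}I\end{bmatrix},$$ let $\Lambda(C,D_\theta)=\{\lambda:\det(C-\lambda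 D_\theta)=0\}$ and $$a_\varepsilon(\theta)=\min\{\mathrm{Arg}(-\mathbf i\lambda)^2:\lambda\in\Lambda(C,D_\theta),\ \mathrm{Re}\,\lambda\le0\},$$ with $\mathrm{Arg}$ the principal argument in $(-\pi,\pi]$ and the convention $\mathrm{Arg}\,0=0$ (needed only when $\varepsilon$ is a singular value of $A-z_0I$). Let $b_\varepsilon$ and the pencil $(S,T_\theta)$ be the analogues of $a_\varepsilon$ and $(C,D_\theta)$ for $B$. Put $$l_\varepsilon(\theta)=-\mu\bigl(\mathcal R_{z_0}(\theta)\cap\Lambda_\varepsilon(A)\cap\Lambda_\varepsilon(B)\bigr),\qquad \mathcal L(\varepsilon)=\{\theta\in(-\pi,\pi]: l_\varepsilon(\theta)<0\},$$ where the ray is identified with $\{r>0\}$ (so $\mu$ is length along the ray). Then for every $\varepsilon\ge 0$: 1. For all $\theta\in\mathbb R$: $l_\varepsilon(\theta)<0$ if and only if $\mathcal R_{z_0}(\theta)\cap\operatorname{int}\Lambda_\varepsilon(A)\cap\operatorname{int}\Lambda_\varepsilon(B)\neq\varnothing$. 2. For all $\theta\in\mathbb R$: if $a_\varepsilon(\theta)+b_\varepsilon(\theta)>0$,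 then $l_\varepsilon(\theta)=0$. 3. $l_\varepsilon$ is continuous on $\mathbb R$ (in particular on $(-\pi,\pi]$). 4. Suppose $z_0$ lies neither on $\operatorname{bd}\Lambda_\varepsilon(A)$ nor on $\operatorname{bd}\Lambda_\varepsilon(B)$. Then $l_\varepsilon$ is differentiable at $\theta\in\mathbb R$ if: for every $r>0$ with $z_0+re^{\mathbf i\theta}\in\operatorname{bd}\Lambda_\varepsilon(A)$, $\mathbf ir$ is a simple eigenvalue of $(C,D_\theta)$ (algebraic multiplicity one) and $\varepsilon$ is a simple singular value of $F_A(r,\theta)$; the analogous conditions hold for every $r>0$ with $z_0+re^{\mathbf i\theta}\in\operatorname{bd}\Lambda_\varepsilon(B)$; and $\mathcal R_{z_0}(\theta)\cap\operatorname{bd}\Lambda_\varepsilon(A)\cap\operatorname{bd}\Lambda_\varepsilon(B)=\varnothing$. 5. $\varepsilon\le\mathrm{sep}_\lambda^{\mathrm D}(A,B)\iff\mu(\mathcal L(\varepsilon))=0$. 6. For all $\varepsilon_1,\varepsilon_2\ge0$: $$\mathrm{sep}_\lambda^{\mathrm D}(A,B)<\varepsilon_1<\varepsilon_2\ \text{ and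 }\ \mu(\mathcal L(\varepsilon_1))<2\pi\iff 0<\mu(\mathcal L(\varepsilon_1))<\mu(\mathcal L(\varepsilon_2)),$$ and $\mathrm{sep}_\lambda^{\mathrm D}(A,B)<\varepsilon_1<\varepsilon_2$ always implies $0<\mu(\mathcal L(\varepsilon_1))\le\mu(\mathcal L(\varepsilon_2))$. (Thus $\mu(\mathcal L(\varepsilon))$ is strictly increasing above $\mathrm{sep}_\lambda^{\mathrm D}(A,B)$ until it reaches its maximal value $2\pi$.) 7. $\min_{\theta\in(-\pi,\pi]}l_\varepsilon(\theta)$ exists, and $\min_{\theta\in(-\pi,\pi]}l_\varepsilon(\theta)<0\iff 0<\mu(\mathcal L(\varepsilon))\iff\mathrm{sep}_\lambda^{\mathrm D}(A,B)<\varepsilon$. -/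

import Mathlib

open MeasureTheory

namespace SepLambda

noncomputable section

open scoped Matrix.Norms.L2Operator in
/-- The spectral norm (operator norm induced by the Euclidean norm). -/
def specNorm {m : ℕ} (M : Matrix (Fin m) (Fin m) ℂ) : ℝ := ‖M‖

/-- The `ε`-pseudospectrum: all eigenvalues of all perturbations `A + Δ` with `‖Δ‖ ≤ ε`. -/
def pseudospectrum {m : ℕ} (A : Matrix (Fin m) (Fin m) ℂ) (ε : ℝ) : Set ℂ :=
  {z | ∃ Δ : Matrix (Fin m) (Fin m) ℂ, specNorm Δ ≤ ε ∧ z ∈ spectrum ℂ (A + Δ)}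

/-- Demmel's `sep_λ(A, B)`: the smallest `ε` such that perturbations of norm at most `ε` of both
matrices can make them share an eigenvalue. -/
def sepD {m n : ℕ} (A : Matrix (Fin m) (Fin m) ℂ) (B : Matrix (Fin n) (Fin n) ℂ) : ℝ :=
  sInf {ε : ℝ | ∃ (E : Matrix (Fin m) (Fin m) ℂ) (F : Matrix (Fin n) (Fin n) ℂ),
    (spectrum ℂ (A + E) ∩ spectrum ℂ (B + F)).Nonempty ∧ max (specNorm E) (specNorm F) ≤ ε}

/-- The point `z₀ + r e^{iθ}`. -/
def rayPoint (z₀ : ℂ) (θ r : ℝ) : ℂ := z₀ + (r : ℂ) * Complex.exp (θ * Complex.I)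

/-- The open ray from `z₀` at angle `θ`. -/
def ray (z₀ : ℂ) (θ : ℝ) : Set ℂ := {z | ∃ r : ℝ, 0 < r ∧ z = rayPoint z₀ θ r}

/-- `F_A(r, θ) = A - (z₀ + r e^{iθ}) I`. -/
def shifted {m : ℕ} (A : Matrix (Fin m) (Fin m) ℂ) (z₀ : ℂ) (r θ : ℝ) :
    Matrix (Fin m) (Fin m) ℂ :=
  A - rayPoint z₀ θ r • (1 : Matrix (Fin m) (Fin m) ℂ)

/-- `s` is a singular value of `M` of multiplicity one. -/
def IsSimpleSingularValue {m : ℕ} (M : Matrix (Fin m) (Fin m) ℂ) (s : ℝ) : Prop :=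
  ∃! i : Fin m, (Matrix.toEuclideanLin M).singularValues i = s

/-- The matrix `C = [[A - z₀ I, -ε I], [ε I, -(A - z₀ I)^*]]`. -/
def pencilC {m : ℕ} (A : Matrix (Fin m) (Fin m) ℂ) (z₀ : ℂ) (ε : ℝ) :
    Matrix (Fin m ⊕ Fin m) (Fin m ⊕ Fin m) ℂ :=
  Matrix.fromBlocks
    (A - z₀ • (1 : Matrix (Fin m) (Fin m) ℂ)) (-((ε : ℂ) • (1 : Matrix (Fin m) (Fin m) ℂ)))
    ((ε : ℂ) • (1 : Matrix (Fin m) (Fin m) ℂ))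
    (-(A - z₀ • (1 : Matrix (Fin m) (Fin m) ℂ)).conjTranspose)

/-- The matrix `D_θ = [[-i e^{iθ} I, 0], [0, i e^{-iθ} I]]`. -/
def pencilD (m : ℕ) (θ : ℝ) : Matrix (Fin m ⊕ Fin m) (Fin m ⊕ Fin m) ℂ :=
  Matrix.fromBlocks
    ((-Complex.I * Complex.exp (θ * Complex.I)) • (1 : Matrix (Fin m) (Fin m) ℂ)) 0
    0 ((Complex.I * Complex.exp (-(θ * Complex.I))) • (1 : Matrix (Fin m) (Fin m) ℂ))

/-- The polynomial `det (P - X Q)` of a matrix pencil `(P, Q)`. -/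
def pencilPoly {ι : Type*} [Fintype ι] [DecidableEq ι] (P Q : Matrix ι ι ℂ) : Polynomial ℂ :=
  (P.map (Polynomial.C : ℂ → Polynomial ℂ)
    - (Polynomial.X : Polynomial ℂ) • Q.map (Polynomial.C : ℂ → Polynomial ℂ)).det

/-- The (finite) spectrum of a matrix pencil `(P, Q)`. -/
def pencilSpectrum {ι : Type*} [Fintype ι] [DecidableEq ι] (P Q : Matrix ι ι ℂ) : Set ℂ :=
  {μ | (P - μ • Q).det = 0}

/-- `μ` is an eigenvalue of the pencil `(P, Q)` of algebraic multiplicity one. -/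
def IsSimplePencilEigenvalue {ι : Type*} [Fintype ι] [DecidableEq ι]
    (P Q : Matrix ι ι ℂ) (μ : ℂ) : Prop :=
  (pencilPoly P Q).rootMultiplicity μ = 1

/-- `a_ε(θ) = min {Arg(-iλ)² : λ ∈ Λ(C, D_θ), Re λ ≤ 0}`, a minimum over a finite set. If `0` is an
eigenvalue of the pencil (that is, if `ε` is a singular value of `A - z₀ I`), `Arg 0` is read
as `0`. -/
def argMin {m : ℕ} (A : Matrix (Fin m) (Fin m) ℂ) (z₀ : ℂ) (ε θ : ℝ) : ℝ :=
  sInf {x : ℝ | ∃ μ ∈ pencilSpectrum (pencilC A z₀ ε) (pencilD m θ),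
    μ.re ≤ 0 ∧ x = Complex.arg (-Complex.I * μ) ^ 2}

/-- `l_ε(θ)`: minus the length of the part of the ray at angle `θ` inside both pseudospectra. The
ray is identified isometrically with the half-line `r > 0`. -/
def overlapLen {m n : ℕ} (A : Matrix (Fin m) (Fin m) ℂ) (B : Matrix (Fin n) (Fin n) ℂ)
    (z₀ : ℂ) (ε θ : ℝ) : ℝ :=
  -(volume {r : ℝ | 0 < r ∧ rayPoint z₀ θ r ∈ pseudospectrum A ε ∩ pseudospectrum B ε}).toReal

/-- `L(ε) = {θ ∈ (-π, π] : l_ε(θ) < 0}`. -/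
def overlapSet {m n : ℕ} (A : Matrix (Fin m) (Fin m) ℂ) (B : Matrix (Fin n) (Fin n) ℂ)
    (z₀ : ℂ) (ε : ℝ) : Set ℝ :=
  {θ | θ ∈ Set.Ioc (-Real.pi) Real.pi ∧ overlapLen A B z₀ ε θ < 0}

/-- The simplicity condition for `A` on the ray at angle `θ`: for every boundary point
`z₀ + r e^{iθ}`, `r > 0`, of the pseudospectrum of `A`, `i r` is a simple eigenvalue of `(C, D_θ)`
and `ε` is a simple singular value of `F_A(r, θ)`. -/
def SimpleOnRay {m : ℕ} (A : Matrix (Fin m) (Fin m) ℂ) (z₀ : ℂ) (ε θ : ℝ) : Prop :=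
  ∀ r : ℝ, 0 < r → rayPoint z₀ θ r ∈ frontier (pseudospectrum A ε) →
    IsSimplePencilEigenvalue (pencilC A z₀ ε) (pencilD m θ) (Complex.I * r) ∧
      IsSimpleSingularValue (shifted A z₀ r θ) ε

end

end SepLambda

/-! Everything rests on the real function `gramDet`, the determinant of `(A - z)ᴴ (A - z) - ε²`. Off
the pseudospectrum this matrix is positive definite, so `gramDet` is positive (`gramDet_pos`). At a
point of the pseudospectrum where `gramDet` does not vanish, some `ε' < ε` already suffices, and the
point is interior (`exists_lt_mem_pseudospectrum`). Hence the boundary lies in the zero set. Along a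
ray, `gramDet` is up to sign `det (C - i r D_θ)`, a nonzero polynomial in `r`, so each ray carries
finitely many zeros.

Positive overlap length therefore yields a point interior to both sets and lying in both
pseudospectra for a smaller `ε`; this gives the interior criterion and the comparison with `sepD`.
The outermost radius inside a pseudospectrum is a zero, hence an eigenvalue `i r` of argument zero,
which settles the `argMin` test. Continuity in the angle is convergence of indicators off a finite
set. Differentiability comes from the implicit function theorem at simple zeros
(`exists_boundary_curve`). Strict growth of the angular set comes from connectedness of `ℝ`
(`volume_overlapSet_lt`): an open periodic set containing the closure of the smaller one cannot
equal that closure unless it is empty or everything. -/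

namespace SepLambda

open Matrix Filter Topology ComplexOrder

/-! ### Pseudospectra through approximate eigenvectors and the Gram determinant. -/

section Pseudospectrum

/-- The Hermitian matrix `(A - z)ᴴ (A - z) - ε²`, positive definite off the pseudospectrum. -/
def gram {m : ℕ} (A : Matrix (Fin m) (Fin m) ℂ) (ε : ℝ) (z : ℂ) : Matrix (Fin m) (Fin m) ℂ :=
  (A - z • (1 : Matrix (Fin m) (Fin m) ℂ))ᴴ * (A - z • (1 : Matrix (Fin m) (Fin m) ℂ))
    - ((ε : ℂ) ^ 2) • (1 : Matrix (Fin m) (Fin m) ℂ)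

/-- The real number `det ((A - z)ᴴ (A - z) - ε²)`. -/
noncomputable def gramDet {m : ℕ} (A : Matrix (Fin m) (Fin m) ℂ) (ε : ℝ) (z : ℂ) : ℝ :=
  (gram A ε z).det.re

variable {m : ℕ} {A : Matrix (Fin m) (Fin m) ℂ} {ε : ℝ} {z : ℂ}

lemma gram_isHermitian : (gram A ε z).IsHermitian := by
  simp [gram, Matrix.IsHermitian, Matrix.conjTranspose_sub, Matrix.conjTranspose_mul,
    Matrix.conjTranspose_smul]

lemma ofReal_gramDet : ((gramDet A ε z : ℝ) : ℂ) = (gram A ε z).det := by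
  apply Complex.ext
  · simp [gramDet]
  · have h := Matrix.det_conjTranspose (gram A ε z)
    rw [gram_isHermitian.eq] at h
    have := congrArg Complex.im h
    simp at this
    simp
    linarith

lemma toEuclideanCLM_shift_apply (v : EuclideanSpace ℂ (Fin m)) :
    Matrix.toEuclideanCLM (𝕜 := ℂ) (A - z • (1 : Matrix (Fin m) (Fin m) ℂ)) v
      = Matrix.toEuclideanCLM (𝕜 := ℂ) A v - z • v := by
  simp

lemma mem_spectrum_iff_exists_eigenvector {M : Matrix (Fin m) (Fin m) ℂ} :
    z ∈ spectrum ℂ M ↔ ∃ v : EuclideanSpace ℂ (Fin m), ‖v‖ = 1 ∧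
      Matrix.toEuclideanCLM (𝕜 := ℂ) M v = z • v := by
  have key : z ∈ spectrum ℂ M ↔
      ∃ v : Fin m → ℂ, v ≠ 0 ∧ (M - z • (1 : Matrix (Fin m) (Fin m) ℂ)) *ᵥ v = 0 := by
    rw [Matrix.exists_mulVec_eq_zero_iff, spectrum.mem_iff, Matrix.isUnit_iff_isUnit_det,
      isUnit_iff_ne_zero, not_not, ← neg_sub M, Matrix.det_neg, Algebra.algebraMap_eq_smul_one]
    simp
  rw [key]
  constructor
  · rintro ⟨v, hv, h⟩
    have hv' : WithLp.toLp 2 v ≠ 0 := by simpa using hv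
    have h' : Matrix.toEuclideanCLM (𝕜 := ℂ) M (WithLp.toLp 2 v) = z • WithLp.toLp 2 v := by
      rw [Matrix.toEuclideanCLM_toLp]
      rw [Matrix.sub_mulVec, sub_eq_zero, Matrix.smul_mulVec, Matrix.one_mulVec] at h
      rw [h, WithLp.toLp_smul]
    refine ⟨((‖WithLp.toLp 2 v‖⁻¹ : ℝ) : ℂ) • WithLp.toLp 2 v, ?_, ?_⟩
    · rw [norm_smul]
      simp only [Complex.norm_real, norm_inv, norm_norm]
      exact inv_mul_cancel₀ (norm_ne_zero_iff.mpr hv')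
    · rw [map_smul, h', smul_comm]
  · rintro ⟨v, hv, h⟩
    refine ⟨v.ofLp, ?_, ?_⟩
    · intro h0
      have : v = 0 := by ext i; simpa using congrFun h0 i
      simp [this] at hv
    · rw [Matrix.sub_mulVec, sub_eq_zero, Matrix.smul_mulVec, Matrix.one_mulVec,
        ← Matrix.ofLp_toEuclideanCLM, h, WithLp.ofLp_smul]

lemma mem_pseudospectrum_iff :
    z ∈ pseudospectrum A ε ↔ ∃ v : EuclideanSpace ℂ (Fin m), ‖v‖ = 1 ∧
      ‖Matrix.toEuclideanCLM (𝕜 := ℂ) A v - z • v‖ ≤ ε := by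
  constructor
  · rintro ⟨Δ, hΔ, hz⟩
    obtain ⟨v, hv, h⟩ := mem_spectrum_iff_exists_eigenvector.mp hz
    refine ⟨v, hv, ?_⟩
    rw [map_add, _root_.add_apply] at h
    have : Matrix.toEuclideanCLM (𝕜 := ℂ) A v - z • v = - Matrix.toEuclideanCLM (𝕜 := ℂ) Δ v := by
      rw [← h]; abel
    rw [this, norm_neg]
    refine (ContinuousLinearMap.le_opNorm _ _).trans ?_
    rw [hv, mul_one]
    exact hΔ
  · rintro ⟨v, hv, h⟩
    set u := Matrix.toEuclideanCLM (𝕜 := ℂ) A v - z • v with hu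
    -- The rank-one perturbation `-u v*` cancels the residual `u` at the unit vector `v` and has
    -- norm `‖u‖`.
    refine ⟨(Matrix.toEuclideanCLM (𝕜 := ℂ) (n := Fin m)).symm
      (-(InnerProductSpace.rankOne ℂ u v)), ?_, ?_⟩
    · rw [specNorm, Matrix.cstar_norm_def, StarAlgEquiv.apply_symm_apply, norm_neg,
        InnerProductSpace.norm_rankOne, hv, mul_one]
      exact h
    · rw [mem_spectrum_iff_exists_eigenvector]
      refine ⟨v, hv, ?_⟩
      rw [map_add, StarAlgEquiv.apply_symm_apply]
      simp only [_root_.add_apply, _root_.neg_apply,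
        InnerProductSpace.rankOne_apply, inner_self_eq_norm_sq_to_K, hv]
      simp [hu]

lemma pseudospectrum_mono {ε' : ℝ} (h : ε ≤ ε') : pseudospectrum A ε ⊆ pseudospectrum A ε' :=
  fun _ ⟨Δ, hΔ, hz⟩ => ⟨Δ, hΔ.trans h, hz⟩

/-- Projection along the compact unit sphere of the closed set of pairs `(v, z)` with small
residual. -/
lemma isClosed_pseudospectrum (A : Matrix (Fin m) (Fin m) ℂ) (ε : ℝ) :
    IsClosed (pseudospectrum A ε) := by
  let K := Metric.sphere (0 : EuclideanSpace ℂ (Fin m)) 1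
  have : CompactSpace K := isCompact_iff_compactSpace.mp (isCompact_sphere _ _)
  have hc : IsClosed {p : K × ℂ |
      ‖Matrix.toEuclideanCLM (𝕜 := ℂ) A (p.1 : EuclideanSpace ℂ (Fin m)) - p.2 • (p.1 : EuclideanSpace ℂ (Fin m))‖ ≤ ε} := by
    apply isClosed_le _ continuous_const
    fun_prop
  convert isClosedMap_snd_of_compactSpace _ hc using 1
  ext z
  rw [mem_pseudospectrum_iff]
  constructor
  · rintro ⟨v, hv, h⟩
    exact ⟨(⟨v, by simpa [K] using hv⟩, z), h, rfl⟩
  · rintro ⟨⟨⟨v, hv⟩, w⟩, h, rfl⟩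
    exact ⟨v, by simpa [K] using hv, h⟩

lemma isBounded_pseudospectrum (A : Matrix (Fin m) (Fin m) ℂ) (ε : ℝ) :
    Bornology.IsBounded (pseudospectrum A ε) := by
  rw [isBounded_iff_forall_norm_le]
  refine ⟨‖Matrix.toEuclideanCLM (𝕜 := ℂ) A‖ + ε, fun z hz => ?_⟩
  obtain ⟨v, hv, h⟩ := mem_pseudospectrum_iff.mp hz
  have h1 : ‖z • v‖ ≤ ‖Matrix.toEuclideanCLM (𝕜 := ℂ) A v‖ +
      ‖Matrix.toEuclideanCLM (𝕜 := ℂ) A v - z • v‖ := by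
    rw [norm_sub_rev]
    exact norm_le_insert' _ _
  have h2 := (Matrix.toEuclideanCLM (𝕜 := ℂ) A).le_opNorm v
  rw [norm_smul, hv, mul_one] at h1
  rw [hv, mul_one] at h2
  linarith

/-- The residual at a fixed unit vector changes by at most `|w - z|`, which leaves room for a ball
of radius `ε - ε'`. -/
lemma pseudospectrum_subset_interior {ε' : ℝ} (h : ε' < ε) :
    pseudospectrum A ε' ⊆ interior (pseudospectrum A ε) := by
  intro z hz
  obtain ⟨v, hv, hle⟩ := mem_pseudospectrum_iff.mp hz
  rw [mem_interior_iff_mem_nhds]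
  filter_upwards [Metric.ball_mem_nhds z (sub_pos.mpr h)] with w hw
  refine mem_pseudospectrum_iff.mpr ⟨v, hv, ?_⟩
  have : Matrix.toEuclideanCLM (𝕜 := ℂ) A v - w • v =
      (Matrix.toEuclideanCLM (𝕜 := ℂ) A v - z • v) - (w - z) • v := by
    rw [sub_smul]; abel
  rw [this]
  refine (norm_sub_le _ _).trans ?_
  rw [norm_smul, hv, mul_one]
  rw [Metric.mem_ball, dist_eq_norm] at hw
  linarith

lemma star_dotProduct_gram_mulVec (v : EuclideanSpace ℂ (Fin m)) :
    star v.ofLp ⬝ᵥ (gram A ε z *ᵥ v.ofLp) =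
      ((‖Matrix.toEuclideanCLM (𝕜 := ℂ) A v - z • v‖ ^ 2 - ε ^ 2 * ‖v‖ ^ 2 : ℝ) : ℂ) := by
  have key (w : EuclideanSpace ℂ (Fin m)) : star w.ofLp ⬝ᵥ w.ofLp = ((‖w‖ ^ 2 : ℝ) : ℂ) := by
    have := inner_self_eq_norm_sq_to_K (𝕜 := ℂ) w
    rw [EuclideanSpace.inner_eq_star_dotProduct, dotProduct_comm] at this
    rw [this]; simp
  rw [gram, Matrix.sub_mulVec, dotProduct_sub, ← Matrix.mulVec_mulVec, Matrix.dotProduct_mulVec,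
    Matrix.vecMul_conjTranspose, star_star, ← Matrix.ofLp_toEuclideanCLM,
    toEuclideanCLM_shift_apply, key, Matrix.smul_mulVec, Matrix.one_mulVec, dotProduct_smul, key]
  push_cast
  simp

lemma posDef_gram (hε : 0 ≤ ε) (hz : z ∉ pseudospectrum A ε) : (gram A ε z).PosDef := by
  rw [Matrix.posDef_iff_dotProduct_mulVec]
  refine ⟨gram_isHermitian, fun x hx => ?_⟩
  have h0 := star_dotProduct_gram_mulVec (A := A) (ε := ε) (z := z) (WithLp.toLp 2 x)
  rw [show (WithLp.toLp 2 x).ofLp = x from rfl] at h0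
  rw [h0]
  norm_cast
  have hx' : WithLp.toLp 2 x ≠ 0 := by simpa using hx
  set v := WithLp.toLp 2 x
  have hv : 0 < ‖v‖ := norm_pos_iff.mpr hx'
  by_contra hcon
  apply hz
  rw [mem_pseudospectrum_iff]
  refine ⟨((‖v‖⁻¹ : ℝ) : ℂ) • v, ?_, ?_⟩
  · rw [norm_smul]
    simp only [Complex.norm_real, norm_inv, norm_norm]
    exact inv_mul_cancel₀ hv.ne'
  · rw [map_smul, smul_comm, ← smul_sub, norm_smul]
    simp only [Complex.norm_real, norm_inv, norm_norm]
    rw [inv_mul_le_iff₀ hv]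
    have : ‖Matrix.toEuclideanCLM (𝕜 := ℂ) A v - z • v‖ ^ 2 ≤ (‖v‖ * ε) ^ 2 := by
      rw [mul_pow]; linarith
    exact abs_le_of_sq_le_sq' this (by positivity) |>.2

lemma gramDet_pos (hε : 0 ≤ ε) (hz : z ∉ pseudospectrum A ε) : 0 < gramDet A ε z := by
  have := (posDef_gram hε hz).det_pos
  rw [← ofReal_gramDet] at this
  exact_mod_cast this

/-- If no smaller `ε'` worked, the Gram matrix would be positive semidefinite, hence positive
definite as its determinant is nonzero; but the unit vector witnessing membership gives its form a
value at most `0`. -/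
lemma exists_lt_mem_pseudospectrum (hε : 0 ≤ ε) (hz : z ∈ pseudospectrum A ε)
    (hd : gramDet A ε z ≠ 0) : ∃ ε' < ε, z ∈ pseudospectrum A ε' := by
  by_contra! hcon
  have hps : (gram A ε z).PosSemidef := by
    refine Matrix.PosSemidef.of_dotProduct_mulVec_nonneg gram_isHermitian fun x => ?_
    have h0 := star_dotProduct_gram_mulVec (A := A) (ε := ε) (z := z) (WithLp.toLp 2 x)
    rw [show (WithLp.toLp 2 x).ofLp = x from rfl] at h0
    rw [h0]
    norm_cast
    set v := WithLp.toLp 2 x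
    rcases eq_or_ne v 0 with hv | hv
    · simp [hv]
    have hv : 0 < ‖v‖ := norm_pos_iff.mpr hv
    by_contra hlt
    have h1 : ‖Matrix.toEuclideanCLM (𝕜 := ℂ) A v - z • v‖ < ‖v‖ * ε :=
      lt_of_pow_lt_pow_left₀ 2 (by positivity) (by rw [mul_pow]; linarith)
    refine hcon (‖v‖⁻¹ * ‖Matrix.toEuclideanCLM (𝕜 := ℂ) A v - z • v‖)
      ((inv_mul_lt_iff₀ hv).mpr h1) (mem_pseudospectrum_iff.mpr
        ⟨((‖v‖⁻¹ : ℝ) : ℂ) • v, ?_, ?_⟩)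
    · rw [norm_smul]
      simp only [Complex.norm_real, norm_inv, norm_norm]
      exact inv_mul_cancel₀ hv.ne'
    · rw [map_smul, smul_comm, ← smul_sub, norm_smul]
      simp only [Complex.norm_real, norm_inv, norm_norm]
      exact le_rfl
  have hpd : (gram A ε z).PosDef := hps.posDef_iff_det_ne_zero.mpr (by
    rw [← ofReal_gramDet]; exact_mod_cast hd)
  obtain ⟨v, hv, h⟩ := mem_pseudospectrum_iff.mp hz
  have hx : v.ofLp ≠ 0 := by
    intro h0
    have : v = 0 := by ext i; simpa using congrFun h0 i
    simp [this] at hv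
  have := hpd.dotProduct_mulVec_pos hx
  rw [star_dotProduct_gram_mulVec, hv] at this
  norm_cast at this
  have h2 := pow_le_pow_left₀ (norm_nonneg _) h 2
  simp only [one_pow] at this
  norm_num at this
  linarith

lemma mem_interior_of_gramDet_ne_zero (hε : 0 ≤ ε) (hz : z ∈ pseudospectrum A ε)
    (hd : gramDet A ε z ≠ 0) : z ∈ interior (pseudospectrum A ε) := by
  obtain ⟨ε', h, hz'⟩ := exists_lt_mem_pseudospectrum hε hz hd
  exact pseudospectrum_subset_interior h hz'

lemma gramDet_eq_zero_of_mem_frontier (hε : 0 ≤ ε) (hz : z ∈ frontier (pseudospectrum A ε)) :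
    gramDet A ε z = 0 := by
  by_contra hd
  rw [(isClosed_pseudospectrum A ε).frontier_eq] at hz
  exact hz.2 (mem_interior_of_gramDet_ne_zero hε hz.1 hd)

lemma zero_mem_spectrum_zero (hm : 0 < m) : (0 : ℂ) ∈ spectrum ℂ (0 : Matrix (Fin m) (Fin m) ℂ) := by
  rw [mem_spectrum_iff_exists_eigenvector]
  exact ⟨EuclideanSpace.single ⟨0, hm⟩ 1, by simp, by simp⟩

lemma exists_mem_pseudospectra_of_sepD_lt {n : ℕ} {B : Matrix (Fin n) (Fin n) ℂ} (hm : 0 < m)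
    (hn : 0 < n) (h : sepD A B < ε) :
    ∃ ε' < ε, (pseudospectrum A ε' ∩ pseudospectrum B ε').Nonempty := by
  obtain ⟨ε', ⟨E, F, ⟨z, hzE, hzF⟩, hmax⟩, hlt⟩ := exists_lt_of_csInf_lt (by
    -- The infimum is over a nonempty set: these perturbations turn both matrices into zero, which
    -- has eigenvalue `0` because the sizes are positive.
    refine ⟨_, -A, -B, ⟨0, ?_, ?_⟩, le_rfl⟩
    · simpa using zero_mem_spectrum_zero hm
    · simpa using zero_mem_spectrum_zero hn) h
  exact ⟨ε', hlt, z, ⟨E, (le_max_left _ _).trans hmax, hzE⟩, ⟨F, (le_max_right _ _).trans hmax, hzF⟩⟩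

lemma sepD_le_of_mem {n : ℕ} {B : Matrix (Fin n) (Fin n) ℂ} (hA : z ∈ pseudospectrum A ε)
    (hB : z ∈ pseudospectrum B ε) : sepD A B ≤ ε := by
  obtain ⟨E, hE, hzE⟩ := hA
  obtain ⟨F, hF, hzF⟩ := hB
  refine csInf_le ⟨0, ?_⟩ ⟨E, F, ⟨z, hzE, hzF⟩, max_le hE hF⟩
  rintro x ⟨E, F, -, h⟩
  refine le_trans ?_ ((le_max_left _ _).trans h)
  exact norm_nonneg (Matrix.toEuclideanCLM (𝕜 := ℂ) E)

end Pseudospectrum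

/-! ### The pencil determinant as a polynomial along a ray. -/

section Pencil

variable {m : ℕ} {A : Matrix (Fin m) (Fin m) ℂ} {ε : ℝ} {z z₀ : ℂ} {θ r : ℝ}

lemma det_fromBlocks_scalar_conjTranspose (F : Matrix (Fin m) (Fin m) ℂ) (e : ℂ) :
    (Matrix.fromBlocks F (-(e • (1 : Matrix (Fin m) (Fin m) ℂ))) (e • 1) (-Fᴴ)).det =
      (-1) ^ m * (Fᴴ * F - e ^ 2 • (1 : Matrix (Fin m) (Fin m) ℂ)).det := by
  rcases eq_or_ne e 0 with rfl | he
  · simp [Matrix.det_neg]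
    ring
  -- Unipotent row and column operations clear the lower right block and make the upper left one the
  -- identity, so no invertibility of `F` is needed.
  have h1 : Matrix.fromBlocks (1 : Matrix (Fin m) (Fin m) ℂ) 0 (-(e⁻¹ • Fᴴ)) 1 *
      Matrix.fromBlocks F (-(e • (1 : Matrix (Fin m) (Fin m) ℂ))) (e • 1) (-Fᴴ) *
      Matrix.fromBlocks (1 : Matrix (Fin m) (Fin m) ℂ) 0 (e⁻¹ • (F - 1)) 1 =
      Matrix.fromBlocks 1 (-(e • (1 : Matrix (Fin m) (Fin m) ℂ)))
        (-(e⁻¹ • (Fᴴ * F - e ^ 2 • (1 : Matrix (Fin m) (Fin m) ℂ)))) 0 := by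
    rw [Matrix.fromBlocks_multiply, Matrix.fromBlocks_multiply]
    congr 1 <;> simp [smul_smul, he, smul_sub, pow_two]
    abel
  have h2 := congrArg Matrix.det h1
  rw [Matrix.det_mul, Matrix.det_mul, Matrix.det_fromBlocks_zero₁₂, Matrix.det_fromBlocks_zero₁₂,
    Matrix.det_fromBlocks_one₁₁] at h2
  simp only [Matrix.det_one, mul_one, one_mul] at h2
  have h3 := Matrix.det_neg (Fᴴ * F - e ^ 2 • (1 : Matrix (Fin m) (Fin m) ℂ))
  rw [Fintype.card_fin] at h3
  rw [h2, ← h3]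
  congr 1
  simp [smul_smul, he]

lemma pencil_eq (A : Matrix (Fin m) (Fin m) ℂ) (z₀ : ℂ) (ε θ r : ℝ) :
    pencilC A z₀ ε - (Complex.I * r) • pencilD m θ =
      Matrix.fromBlocks (A - rayPoint z₀ θ r • (1 : Matrix (Fin m) (Fin m) ℂ))
        (-((ε : ℂ) • (1 : Matrix (Fin m) (Fin m) ℂ))) ((ε : ℂ) • 1)
        (-(A - rayPoint z₀ θ r • (1 : Matrix (Fin m) (Fin m) ℂ))ᴴ) := by
  have hI (x : ℂ) : Complex.I * r * (-Complex.I * x) = r * x := by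
    linear_combination (-r * x) * Complex.I_mul_I
  have hI' (x : ℂ) : Complex.I * r * (Complex.I * x) = - (r * x) := by
    linear_combination (r * x) * Complex.I_mul_I
  have hconj : (starRingEnd ℂ) (Complex.exp (θ * Complex.I)) = Complex.exp (-(θ * Complex.I)) := by
    rw [← Complex.exp_conj]; simp
  rw [pencilC, pencilD, Matrix.fromBlocks_smul, sub_eq_add_neg, Matrix.fromBlocks_neg,
    Matrix.fromBlocks_add]
  congr 1
  · rw [smul_smul, hI, rayPoint, add_smul]
    abel
  · simp
  · simp
  · rw [smul_smul, hI', Matrix.conjTranspose_sub, Matrix.conjTranspose_sub,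
      Matrix.conjTranspose_smul, Matrix.conjTranspose_smul, Matrix.conjTranspose_one, rayPoint]
    simp only [star_add, star_mul', RCLike.star_def, hconj, Complex.conj_ofReal, add_smul, neg_smul]
    abel

lemma det_pencil_eq (A : Matrix (Fin m) (Fin m) ℂ) (z₀ : ℂ) (ε θ r : ℝ) :
    (pencilC A z₀ ε - (Complex.I * r) • pencilD m θ).det =
      (-1) ^ m * (gramDet A ε (rayPoint z₀ θ r) : ℂ) := by
  rw [pencil_eq, det_fromBlocks_scalar_conjTranspose, ofReal_gramDet, gram]

lemma eval_pencilPoly {ι : Type*} [Fintype ι] [DecidableEq ι] (P Q : Matrix ι ι ℂ) (μ : ℂ) :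
    (pencilPoly P Q).eval μ = (P - μ • Q).det := by
  rw [pencilPoly, ← Polynomial.coe_evalRingHom, RingHom.map_det]
  congr 1
  ext i j
  simp
  ring

lemma norm_rayPoint_sub (z₀ : ℂ) (θ r : ℝ) : ‖rayPoint z₀ θ r - z₀‖ = |r| := by
  rw [rayPoint, add_sub_cancel_left, norm_mul, Complex.norm_exp_ofReal_mul_I, mul_one,
    Complex.norm_real, Real.norm_eq_abs]

lemma exists_pos_forall_rayPoint_mem (A : Matrix (Fin m) (Fin m) ℂ) (z₀ : ℂ) (ε : ℝ) :
    ∃ R : ℝ, 0 < R ∧ ∀ θ r, rayPoint z₀ θ r ∈ pseudospectrum A ε → r < R := by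
  obtain ⟨R, hR, h⟩ := (isBounded_pseudospectrum A ε).exists_pos_norm_lt
  refine ⟨R + ‖z₀‖, by positivity, fun θ r hr => ?_⟩
  have h1 := norm_rayPoint_sub z₀ θ r
  have h2 := norm_sub_le (rayPoint z₀ θ r) z₀
  have h3 := h _ hr
  have h4 := le_abs_self r
  linarith

/-- Far out on the ray the point has left the bounded pseudospectrum, where the determinant is
nonzero. -/
lemma pencilPoly_ne_zero (hε : 0 ≤ ε) : pencilPoly (pencilC A z₀ ε) (pencilD m θ) ≠ 0 := by
  obtain ⟨R, -, h⟩ := exists_pos_forall_rayPoint_mem A z₀ ε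
  intro h0
  have h1 := det_pencil_eq A z₀ ε θ R
  rw [← eval_pencilPoly, h0, Polynomial.eval_zero] at h1
  have h2 := gramDet_pos (A := A) hε fun hmem => lt_irrefl _ (h θ R hmem)
  have h3 : ((gramDet A ε (rayPoint z₀ θ R) : ℝ) : ℂ) ≠ 0 := by exact_mod_cast h2.ne'
  exact (mul_ne_zero (by simp) h3) h1.symm

lemma finite_setOf_gramDet_eq_zero (hε : 0 ≤ ε) (A : Matrix (Fin m) (Fin m) ℂ) (z₀ : ℂ) (θ : ℝ) :
    {r : ℝ | gramDet A ε (rayPoint z₀ θ r) = 0}.Finite := by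
  have hfin := Polynomial.finite_setOfPred_isRoot (pencilPoly_ne_zero (A := A) (z₀ := z₀) (θ := θ) hε)
  refine (hfin.preimage (f := fun r : ℝ => Complex.I * r) ?_).subset ?_
  · intro x _ y _ h
    simpa using h
  · intro r hr
    simp only [Set.mem_ofPred_eq] at hr
    simp [Polynomial.IsRoot, eval_pencilPoly, det_pencil_eq, hr]

lemma finite_setOf_rayPoint_mem_frontier (hε : 0 ≤ ε) (A : Matrix (Fin m) (Fin m) ℂ) (z₀ : ℂ)
    (θ : ℝ) : {r : ℝ | rayPoint z₀ θ r ∈ frontier (pseudospectrum A ε)}.Finite :=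
  (finite_setOf_gramDet_eq_zero hε A z₀ θ).subset fun _ => gramDet_eq_zero_of_mem_frontier hε

@[fun_prop]
lemma continuous_rayPoint : Continuous fun p : ℝ × ℝ => rayPoint z₀ p.1 p.2 := by
  unfold rayPoint; fun_prop

lemma continuous_rayPoint_right : Continuous fun r : ℝ => rayPoint z₀ θ r := by
  unfold rayPoint; fun_prop

lemma contDiff_gramDet_rayPoint (A : Matrix (Fin m) (Fin m) ℂ) (z₀ : ℂ) (ε : ℝ) :
    ContDiff ℝ 1 fun p : ℝ × ℝ => gramDet A ε (rayPoint z₀ p.1 p.2) := by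
  have hray : ContDiff ℝ 1 fun p : ℝ × ℝ => rayPoint z₀ p.1 p.2 := by
    unfold rayPoint
    have h1 : ContDiff ℝ 1 fun p : ℝ × ℝ => ((p.1 : ℝ) : ℂ) :=
      Complex.ofRealCLM.contDiff.comp contDiff_fst
    have h2 : ContDiff ℝ 1 fun p : ℝ × ℝ => ((p.2 : ℝ) : ℂ) :=
      Complex.ofRealCLM.contDiff.comp contDiff_snd
    exact contDiff_const.add (h2.mul (h1.mul contDiff_const).cexp)
  have hentry (i j : Fin m) : ContDiff ℝ 1 fun p : ℝ × ℝ =>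
      (A - rayPoint z₀ p.1 p.2 • (1 : Matrix (Fin m) (Fin m) ℂ)) i j := by
    simp only [Matrix.sub_apply, Matrix.smul_apply, smul_eq_mul]
    exact contDiff_const.sub (hray.mul contDiff_const)
  have hgram (i j : Fin m) : ContDiff ℝ 1 fun p : ℝ × ℝ => gram A ε (rayPoint z₀ p.1 p.2) i j := by
    simp only [gram, Matrix.sub_apply (_ * _), Matrix.mul_apply, Matrix.conjTranspose_apply]
    refine ContDiff.sub (ContDiff.sum fun k _ => ContDiff.mul ?_ (hentry k j)) contDiff_const
    exact Complex.conjCLE.contDiff.comp (hentry k i)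
  unfold gramDet
  simp only [Matrix.det_apply]
  refine Complex.reCLM.contDiff.comp (ContDiff.sum fun σ _ => ?_)
  exact ContDiff.const_smul _ (contDiff_prod fun i _ => hgram _ _)

/-- A simple root has nonzero polynomial derivative. The resulting complex derivative `d` along the
real radius is that of a real-valued function, so its imaginary part vanishes and its real part
cannot. -/
lemma exists_hasDerivAt_gramDet_ne_zero (hε : 0 ≤ ε)
    (hsimple : IsSimplePencilEigenvalue (pencilC A z₀ ε) (pencilD m θ) (Complex.I * r)) :
    ∃ c : ℝ, c ≠ 0 ∧ HasDerivAt (fun s : ℝ => gramDet A ε (rayPoint z₀ θ s)) c r := by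
  set P := pencilPoly (pencilC A z₀ ε) (pencilD m θ) with hP
  have hev (s : ℝ) : P.eval (Complex.I * s) = (-1) ^ m * (gramDet A ε (rayPoint z₀ θ s) : ℂ) := by
    rw [hP, eval_pencilPoly, det_pencil_eq]
  have hroot : P.eval (Complex.I * r) = 0 := by
    have : 0 < P.rootMultiplicity (Complex.I * r) := by
      rw [show P.rootMultiplicity (Complex.I * r) = 1 from hsimple]; exact one_pos
    exact ((Polynomial.rootMultiplicity_pos'.mp this).2)
  have hder : P.derivative.eval (Complex.I * r) ≠ 0 := by
    intro h0
    have := (Polynomial.one_lt_rootMultiplicity_iff_isRoot (pencilPoly_ne_zero hε)).mpr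
      ⟨hroot, h0⟩
    rw [show P.rootMultiplicity (Complex.I * r) = 1 from hsimple] at this
    exact lt_irrefl _ this
  have hd : HasDerivAt (fun s : ℝ => ((gramDet A ε (rayPoint z₀ θ s) : ℝ) : ℂ))
      ((-1) ^ m * (P.derivative.eval (Complex.I * r) * Complex.I)) r := by
    have h1 : HasDerivAt (fun s : ℝ => Complex.I * (s : ℂ)) Complex.I r := by
      simpa using (Complex.ofRealCLM.hasDerivAt (x := r)).const_mul Complex.I
    have h2 := ((P.hasDerivAt (Complex.I * r)).comp r h1).const_mul ((-1) ^ m)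
    refine h2.congr_of_eventuallyEq (Eventually.of_forall fun s => ?_)
    simp only [Function.comp, hev]
    rw [← mul_assoc, ← mul_pow]; simp
  set d := (-1) ^ m * (P.derivative.eval (Complex.I * r) * Complex.I) with hd'
  have hd0 : d ≠ 0 := mul_ne_zero (by simp) (mul_ne_zero hder Complex.I_ne_zero)
  have hre := Complex.reCLM.hasFDerivAt.comp_hasDerivAt r hd
  have him := Complex.imCLM.hasFDerivAt.comp_hasDerivAt r hd
  refine ⟨d.re, fun h => hd0 (Complex.ext h ?_), ?_⟩
  · have h0 : HasDerivAt (fun _ : ℝ => (0 : ℝ)) (Complex.imCLM d) r := by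
      refine him.congr_of_eventuallyEq (Eventually.of_forall fun s => ?_)
      simp
    have := h0.unique (hasDerivAt_const r (0 : ℝ))
    simpa using this
  · refine (hre.congr_of_eventuallyEq (Eventually.of_forall fun s => ?_))
    simp

end Pencil

/-! ### Overlap length on a single ray, and its continuity in the angle. -/

section Overlap

lemma eventually_mem_iff_of_notMem_frontier {X : Type*} [TopologicalSpace X] {S : Set X} {x : X}
    (hx : x ∉ frontier S) : ∀ᶠ y in 𝓝 x, (y ∈ S ↔ x ∈ S) := by
  by_cases hxS : x ∈ S
  · have : x ∈ interior S := by
      by_contra h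
      exact hx ⟨subset_closure hxS, h⟩
    filter_upwards [mem_interior_iff_mem_nhds.mp this] with y hy
    simp [hy, hxS]
  · have : x ∉ closure S := fun h => hx ⟨h, fun hi => hxS (interior_subset hi)⟩
    filter_upwards [isClosed_closure.isOpen_compl.mem_nhds this] with y hy
    have : y ∉ S := fun h => hy (subset_closure h)
    simp [this, hxS]

variable {m n : ℕ} {A : Matrix (Fin m) (Fin m) ℂ} {B : Matrix (Fin n) (Fin n) ℂ}
  {ε : ℝ} {z z₀ : ℂ} {θ r : ℝ}

/-- The set of radii at which the ray at angle `θ` lies in both pseudospectra. -/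
def overlapSlice (A : Matrix (Fin m) (Fin m) ℂ) (B : Matrix (Fin n) (Fin n) ℂ)
    (z₀ : ℂ) (ε θ : ℝ) : Set ℝ :=
  {r : ℝ | 0 < r ∧ rayPoint z₀ θ r ∈ pseudospectrum A ε ∩ pseudospectrum B ε}

lemma overlapLen_eq : overlapLen A B z₀ ε θ = -(volume (overlapSlice A B z₀ ε θ)).toReal := rfl

lemma measurableSet_overlapSlice : MeasurableSet (overlapSlice A B z₀ ε θ) :=
  measurableSet_Ioi.inter (((isClosed_pseudospectrum A ε).inter
    (isClosed_pseudospectrum B ε)).preimage continuous_rayPoint_right).measurableSet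

lemma exists_overlapSlice_subset (A : Matrix (Fin m) (Fin m) ℂ) (B : Matrix (Fin n) (Fin n) ℂ)
    (z₀ : ℂ) (ε : ℝ) : ∃ R : ℝ, 0 < R ∧ ∀ θ, overlapSlice A B z₀ ε θ ⊆ Set.Ioo 0 R := by
  obtain ⟨R, hR, h⟩ := exists_pos_forall_rayPoint_mem A z₀ ε
  exact ⟨R, hR, fun θ r hr => ⟨hr.1, h θ r hr.2.1⟩⟩

lemma volume_overlapSlice_ne_top : volume (overlapSlice A B z₀ ε θ) ≠ ⊤ := by
  obtain ⟨R, -, h⟩ := exists_overlapSlice_subset A B z₀ ε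
  exact ((measure_mono (h θ)).trans_lt (by simp)).ne

lemma overlapLen_nonpos : overlapLen A B z₀ ε θ ≤ 0 := by
  rw [overlapLen_eq]; simp

lemma overlapLen_neg_iff_volume :
    overlapLen A B z₀ ε θ < 0 ↔ 0 < volume (overlapSlice A B z₀ ε θ) := by
  rw [overlapLen_eq, neg_lt_zero, ENNReal.toReal_pos_iff]
  exact ⟨And.left, fun h => ⟨h, volume_overlapSlice_ne_top.lt_top⟩⟩

lemma overlapLen_neg_of_mem_interior (hr : 0 < r)
    (hA : rayPoint z₀ θ r ∈ interior (pseudospectrum A ε))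
    (hB : rayPoint z₀ θ r ∈ interior (pseudospectrum B ε)) : overlapLen A B z₀ ε θ < 0 := by
  rw [overlapLen_neg_iff_volume]
  have ho : IsOpen (Set.Ioi 0 ∩ (fun s => rayPoint z₀ θ s) ⁻¹'
      (interior (pseudospectrum A ε) ∩ interior (pseudospectrum B ε))) :=
    isOpen_Ioi.inter ((isOpen_interior.inter isOpen_interior).preimage continuous_rayPoint_right)
  refine (ho.measure_pos volume ⟨r, hr, hA, hB⟩).trans_le (measure_mono ?_)
  rintro s ⟨hs, hsA, hsB⟩
  exact ⟨hs, interior_subset hsA, interior_subset hsB⟩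

/-- A set of positive length is not covered by the finitely many zeros of the two determinants. -/
lemma exists_gramDet_ne_zero_of_overlapLen_neg (hε : 0 ≤ ε) (h : overlapLen A B z₀ ε θ < 0) :
    ∃ r ∈ overlapSlice A B z₀ ε θ,
      gramDet A ε (rayPoint z₀ θ r) ≠ 0 ∧ gramDet B ε (rayPoint z₀ θ r) ≠ 0 := by
  rw [overlapLen_neg_iff_volume] at h
  by_contra! hcon
  have hfin := (finite_setOf_gramDet_eq_zero hε A z₀ θ).union
    (finite_setOf_gramDet_eq_zero hε B z₀ θ)
  have hsub : overlapSlice A B z₀ ε θ ⊆ {r : ℝ | gramDet A ε (rayPoint z₀ θ r) = 0} ∪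
      {r : ℝ | gramDet B ε (rayPoint z₀ θ r) = 0} := by
    intro r hr
    by_cases h0 : gramDet A ε (rayPoint z₀ θ r) = 0
    · exact Or.inl h0
    · exact Or.inr (hcon r hr h0)
  exact h.ne' ((hfin.subset hsub).measure_zero volume)

lemma overlapLen_neg_iff (hε : 0 ≤ ε) : overlapLen A B z₀ ε θ < 0 ↔
    (ray z₀ θ ∩ interior (pseudospectrum A ε) ∩ interior (pseudospectrum B ε)).Nonempty := by
  constructor
  · intro h
    obtain ⟨r, hr, hA, hB⟩ := exists_gramDet_ne_zero_of_overlapLen_neg hε h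
    exact ⟨rayPoint z₀ θ r, ⟨⟨r, hr.1, rfl⟩, mem_interior_of_gramDet_ne_zero hε hr.2.1 hA⟩,
      mem_interior_of_gramDet_ne_zero hε hr.2.2 hB⟩
  · rintro ⟨_, ⟨⟨r, hr, rfl⟩, hA⟩, hB⟩
    exact overlapLen_neg_of_mem_interior hr hA hB

lemma argMin_nonneg : 0 ≤ argMin A z₀ ε θ := by
  apply Real.sInf_nonneg
  rintro x ⟨μ, -, -, rfl⟩
  positivity

lemma argMin_eq_zero (hε : 0 ≤ ε) (hr : 0 < r) (hmem : rayPoint z₀ θ r ∈ pseudospectrum A ε) :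
    argMin A z₀ ε θ = 0 := by
  obtain ⟨R, hR, hlt⟩ := exists_pos_forall_rayPoint_mem A z₀ ε
  set S : Set ℝ := Set.Icc 0 R ∩ (fun s => rayPoint z₀ θ s) ⁻¹' pseudospectrum A ε with hS
  have hcomp : IsCompact S := isCompact_Icc.inter_right
    ((isClosed_pseudospectrum A ε).preimage continuous_rayPoint_right)
  -- At the outermost radius `s` the determinant must vanish: otherwise the point would be interior
  -- and the ray would stay inside beyond `s`.
  obtain ⟨s, hs, hmax⟩ := hcomp.exists_isGreatest ⟨r, ⟨hr.le, (hlt _ _ hmem).le⟩, hmem⟩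
  have hs0 : 0 < s := hr.trans_le (hmax ⟨⟨hr.le, (hlt _ _ hmem).le⟩, hmem⟩)
  have hzero : gramDet A ε (rayPoint z₀ θ s) = 0 := by
    by_contra hd
    have hint := mem_interior_of_gramDet_ne_zero hε hs.2 hd
    have hev : ∀ᶠ t in 𝓝[>] s, rayPoint z₀ θ t ∈ pseudospectrum A ε :=
      (continuous_rayPoint_right.continuousAt.eventually
        (mem_interior_iff_mem_nhds.mp hint)).filter_mono nhdsWithin_le_nhds
    obtain ⟨t, ht, hst⟩ := (hev.and self_mem_nhdsWithin).exists
    have hst : s < t := hst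
    exact absurd (hmax ⟨⟨(hs0.trans hst).le, (hlt _ _ ht).le⟩, ht⟩) (not_le.mpr hst)
  apply le_antisymm _ argMin_nonneg
  refine csInf_le ⟨0, ?_⟩ ⟨Complex.I * s, ?_, ?_, ?_⟩
  · rintro x ⟨μ, -, -, rfl⟩
    positivity
  · simp [pencilSpectrum, det_pencil_eq, hzero]
  · simp
  · have : -Complex.I * (Complex.I * s) = (s : ℂ) := by
      linear_combination (-(s : ℂ)) * Complex.I_mul_I
    rw [this, Complex.arg_ofReal_of_nonneg hs0.le]
    simp

lemma overlapLen_eq_zero_of_argMin_pos (hε : 0 ≤ ε)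
    (h : 0 < argMin A z₀ ε θ + argMin B z₀ ε θ) : overlapLen A B z₀ ε θ = 0 := by
  by_contra hne
  obtain ⟨r, hr, -⟩ := exists_gramDet_ne_zero_of_overlapLen_neg hε
    (lt_of_le_of_ne overlapLen_nonpos hne)
  rw [argMin_eq_zero hε hr.1 hr.2.1, argMin_eq_zero hε hr.1 hr.2.2, add_zero] at h
  exact lt_irrefl _ h

lemma eventually_rayPoint_mem_iff {S : Set ℂ} (h : rayPoint z₀ θ r ∉ frontier S) :
    ∀ᶠ p : ℝ × ℝ in 𝓝 (θ, r), (rayPoint z₀ p.1 p.2 ∈ S ↔ rayPoint z₀ θ r ∈ S) :=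
  (continuous_rayPoint.continuousAt (x := (θ, r))).eventually
    (eventually_mem_iff_of_notMem_frontier h)

/-- All slices lie in one bounded interval, and their indicators converge at every radius where the
ray avoids both frontiers, that is, off a finite set. -/
lemma continuous_overlapLen (hε : 0 ≤ ε) (A : Matrix (Fin m) (Fin m) ℂ)
    (B : Matrix (Fin n) (Fin n) ℂ) (z₀ : ℂ) : Continuous (overlapLen A B z₀ ε) := by
  obtain ⟨R, -, hR⟩ := exists_overlapSlice_subset A B z₀ ε
  rw [continuous_iff_continuousAt]
  intro θ
  have h : Tendsto (fun φ => volume (overlapSlice A B z₀ ε φ)) (𝓝 θ)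
      (𝓝 (volume (overlapSlice A B z₀ ε θ))) := by
    refine tendsto_measure_of_ae_tendsto_indicator (𝓝 θ) measurableSet_overlapSlice
      (fun _ => measurableSet_overlapSlice) (measurableSet_Ioo (a := (0 : ℝ)) (b := R)) (by simp)
      (Eventually.of_forall hR) ?_
    have hfin := (finite_setOf_rayPoint_mem_frontier hε A z₀ θ).union
      (finite_setOf_rayPoint_mem_frontier hε B z₀ θ)
    filter_upwards [compl_mem_ae_iff.mpr (hfin.measure_zero volume)] with r hr
    have hrA : rayPoint z₀ θ r ∉ frontier (pseudospectrum A ε) := fun h => hr (Or.inl h)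
    have hrB : rayPoint z₀ θ r ∉ frontier (pseudospectrum B ε) := fun h => hr (Or.inr h)
    have ht : Tendsto (fun φ : ℝ => (φ, r)) (𝓝 θ) (𝓝 (θ, r)) := by
      rw [nhds_prod_eq]; exact tendsto_id.prodMk tendsto_const_nhds
    filter_upwards [ht.eventually (eventually_rayPoint_mem_iff hrA),
      ht.eventually (eventually_rayPoint_mem_iff hrB)] with φ h1 h2
    simp only [overlapSlice, Set.mem_ofPred_eq, Set.mem_inter_iff, h1, h2]
  exact ((ENNReal.tendsto_toReal volume_overlapSlice_ne_top).comp h).neg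

/-! ### Periodicity in the angle and the measure of the set of overlapping angles. -/

lemma rayPoint_add_two_pi : rayPoint z₀ (θ + 2 * Real.pi) r = rayPoint z₀ θ r := by
  have : ((θ + 2 * Real.pi : ℝ) : ℂ) * Complex.I = θ * Complex.I + 2 * Real.pi * Complex.I := by
    push_cast; ring
  rw [rayPoint, this, Complex.exp_periodic]
  rfl

lemma periodic_overlapLen : Function.Periodic (overlapLen A B z₀ ε) (2 * Real.pi) := by
  intro θ
  simp only [overlapLen, rayPoint_add_two_pi]

lemma exists_rayPoint_eq (hz : z ≠ z₀) : ∃ θ r, 0 < r ∧ rayPoint z₀ θ r = z := by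
  refine ⟨(z - z₀).arg, ‖z - z₀‖, norm_pos_iff.mpr (sub_ne_zero.mpr hz), ?_⟩
  rw [rayPoint, Complex.norm_mul_exp_arg_mul_I]
  ring

/-- Approaching `x` from the left also covers `x = b`, where the half-open interval is no
neighbourhood of `x`. -/
lemma volume_inter_Ioc_pos {O : Set ℝ} (hO : IsOpen O) {a b x : ℝ} (hx : x ∈ O)
    (hxab : x ∈ Set.Ioc a b) : 0 < volume (O ∩ Set.Ioc a b) := by
  have hev : ∀ᶠ t in 𝓝[<] x, t ∈ O ∩ Set.Ioo a b := by
    have h1 : ∀ᶠ t in 𝓝[<] x, t ∈ O := nhdsWithin_le_nhds (hO.mem_nhds hx)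
    have h2 : ∀ᶠ t in 𝓝[<] x, t ∈ Set.Ioo a x := Ioo_mem_nhdsLT hxab.1
    filter_upwards [h1, h2] with t ht1 ht2
    exact ⟨ht1, ht2.1, ht2.2.trans_le hxab.2⟩
  obtain ⟨t, ht⟩ := hev.exists
  exact ((hO.inter isOpen_Ioo).measure_pos volume ⟨t, ht⟩).trans_le
    (measure_mono (Set.inter_subset_inter_right _ Set.Ioo_subset_Ioc_self))

/-- The angle `φ` does not depend on `ε`, and the integer `k` is kept so that the shift can also be
applied to closures. -/
lemma exists_mem_Ioc_overlapLen_eq (A : Matrix (Fin m) (Fin m) ℂ) (B : Matrix (Fin n) (Fin n) ℂ)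
    (z₀ : ℂ) (θ : ℝ) : ∃ φ ∈ Set.Ioc (-Real.pi) Real.pi, ∃ k : ℤ, φ = θ - k * (2 * Real.pi) ∧
      ∀ ε, overlapLen A B z₀ ε φ = overlapLen A B z₀ ε θ := by
  refine ⟨toIocMod Real.two_pi_pos (-Real.pi) θ, ?_, toIocDiv Real.two_pi_pos (-Real.pi) θ, ?_, ?_⟩
  · have := toIocMod_mem_Ioc Real.two_pi_pos (-Real.pi) θ
    rwa [show -Real.pi + 2 * Real.pi = Real.pi by ring] at this
  · rw [toIocMod]; simp
  · intro ε
    exact periodic_overlapLen.sub_zsmul_eq _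

lemma isOpen_overlapLen_neg (hε : 0 ≤ ε) : IsOpen {θ | overlapLen A B z₀ ε θ < 0} :=
  isOpen_lt (continuous_overlapLen hε A B z₀) continuous_const

lemma overlapSet_eq : overlapSet A B z₀ ε =
    {θ | overlapLen A B z₀ ε θ < 0} ∩ Set.Ioc (-Real.pi) Real.pi := by
  ext θ; exact and_comm

lemma volume_overlapSet_pos_iff (hε : 0 ≤ ε) :
    0 < volume (overlapSet A B z₀ ε) ↔ ∃ θ, overlapLen A B z₀ ε θ < 0 := by
  constructor
  · intro h
    obtain ⟨θ, hθ⟩ := nonempty_of_measure_ne_zero h.ne'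
    exact ⟨θ, hθ.2⟩
  · rintro ⟨θ, hθ⟩
    obtain ⟨φ, hφ, -, -, h⟩ := exists_mem_Ioc_overlapLen_eq A B z₀ θ
    rw [overlapSet_eq]
    exact volume_inter_Ioc_pos (isOpen_overlapLen_neg hε) (by rwa [← h] at hθ) hφ

lemma volume_overlapSet_pos_iff_sepD_lt (hm : 0 < m) (hn : 0 < n) (hε : 0 ≤ ε) :
    0 < volume (overlapSet A B z₀ ε) ↔ sepD A B < ε := by
  rw [volume_overlapSet_pos_iff hε]
  constructor
  · rintro ⟨θ, hθ⟩
    obtain ⟨r, hr, hA, hB⟩ := exists_gramDet_ne_zero_of_overlapLen_neg hε hθ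
    obtain ⟨a, ha, haA⟩ := exists_lt_mem_pseudospectrum hε hr.2.1 hA
    obtain ⟨b, hb, hbB⟩ := exists_lt_mem_pseudospectrum hε hr.2.2 hB
    exact (sepD_le_of_mem (pseudospectrum_mono (le_max_left a b) haA)
      (pseudospectrum_mono (le_max_right a b) hbB)).trans_lt (max_lt ha hb)
  · intro h
    obtain ⟨ε', hlt, z, hzA, hzB⟩ := exists_mem_pseudospectra_of_sepD_lt hm hn h
    have ho : IsOpen (interior (pseudospectrum A ε) ∩ interior (pseudospectrum B ε)) :=
      isOpen_interior.inter isOpen_interior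
    have hz : z ∈ interior (pseudospectrum A ε) ∩ interior (pseudospectrum B ε) :=
      ⟨pseudospectrum_subset_interior hlt hzA, pseudospectrum_subset_interior hlt hzB⟩
    -- The open rays miss `z₀`, so another common point is needed; a nonempty open set in the plane
    -- is not a singleton.
    obtain ⟨w, hwO, hw⟩ : ∃ w ∈ interior (pseudospectrum A ε) ∩ interior (pseudospectrum B ε),
        w ≠ z₀ := by
      by_contra! hcon
      have hsub : interior (pseudospectrum A ε) ∩ interior (pseudospectrum B ε) = {z₀} :=
        Set.eq_singleton_iff_nonempty_unique_mem.mpr ⟨⟨z, hz⟩, hcon⟩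
      rw [hsub] at ho
      exact not_isOpen_singleton z₀ ho
    obtain ⟨θ, r, hr, rfl⟩ := exists_rayPoint_eq hw
    exact ⟨θ, overlapLen_neg_of_mem_interior hr hwO.1 hwO.2⟩

lemma le_sepD_iff_volume_overlapSet_eq_zero (hm : 0 < m) (hn : 0 < n) (hε : 0 ≤ ε) :
    ε ≤ sepD A B ↔ volume (overlapSet A B z₀ ε) = 0 := by
  rw [← not_lt, ← volume_overlapSet_pos_iff_sepD_lt hm hn hε (z₀ := z₀), pos_iff_ne_zero, not_not]

lemma exists_isLeast_overlapLen (hε : 0 ≤ ε) (A : Matrix (Fin m) (Fin m) ℂ)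
    (B : Matrix (Fin n) (Fin n) ℂ) (z₀ : ℂ) :
    ∃ v : ℝ, IsLeast (overlapLen A B z₀ ε '' Set.Ioc (-Real.pi) Real.pi) v ∧
      (v < 0 ↔ 0 < volume (overlapSet A B z₀ ε)) := by
  obtain ⟨θ, -, hmin⟩ := isCompact_Icc.exists_isMinOn (s := Set.Icc (-Real.pi) Real.pi)
    ⟨0, by simp [Real.pi_pos.le]⟩ (continuous_overlapLen hε A B z₀).continuousOn
  obtain ⟨φ, hφ, -, -, h⟩ := exists_mem_Ioc_overlapLen_eq A B z₀ θ
  have hleast : IsLeast (overlapLen A B z₀ ε '' Set.Ioc (-Real.pi) Real.pi)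
      (overlapLen A B z₀ ε θ) := by
    refine ⟨⟨φ, hφ, h ε⟩, ?_⟩
    rintro _ ⟨ψ, hψ, rfl⟩
    exact hmin (Set.Ioc_subset_Icc_self hψ)
  refine ⟨_, hleast, ?_⟩
  rw [volume_overlapSet_pos_iff hε]
  refine ⟨fun h => ⟨θ, h⟩, ?_⟩
  rintro ⟨ψ, hψ⟩
  obtain ⟨φ', hφ', -, -, h'⟩ := exists_mem_Ioc_overlapLen_eq A B z₀ ψ
  refine (hleast.2 ⟨φ', hφ', rfl⟩).trans_lt ?_
  rwa [h']

/-! ### Growth of the set of overlapping angles with `ε`. -/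

lemma overlapLen_anti {ε' : ℝ} (h : ε ≤ ε') : overlapLen A B z₀ ε' θ ≤ overlapLen A B z₀ ε θ := by
  rw [overlapLen_eq, overlapLen_eq, neg_le_neg_iff]
  refine ENNReal.toReal_mono volume_overlapSlice_ne_top (measure_mono ?_)
  rintro r ⟨hr, hA, hB⟩
  exact ⟨hr, pseudospectrum_mono h hA, pseudospectrum_mono h hB⟩

lemma overlapSet_mono {ε' : ℝ} (h : ε ≤ ε') : overlapSet A B z₀ ε ⊆ overlapSet A B z₀ ε' :=
  fun _ hθ => ⟨hθ.1, (overlapLen_anti h).trans_lt hθ.2⟩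

lemma volume_overlapSet_le : volume (overlapSet A B z₀ ε) ≤ ENNReal.ofReal (2 * Real.pi) := by
  refine (measure_mono (fun θ hθ => hθ.1 : overlapSet A B z₀ ε ⊆ Set.Ioc (-Real.pi) Real.pi)).trans ?_
  rw [Real.volume_Ioc]
  exact ENNReal.ofReal_le_ofReal (by linarith)

lemma volume_overlapSet_of_forall (h : ∀ θ, overlapLen A B z₀ ε θ < 0) :
    volume (overlapSet A B z₀ ε) = ENNReal.ofReal (2 * Real.pi) := by
  have : {θ | overlapLen A B z₀ ε θ < 0} = Set.univ := Set.eq_univ_of_forall h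
  rw [overlapSet_eq, this, Set.univ_inter, Real.volume_Ioc]
  congr 1; ring

lemma closure_overlapLen_neg_subset {ε' : ℝ} (h : ε < ε') (hex : ∃ θ, ¬ overlapLen A B z₀ ε' θ < 0) :
    closure {θ | overlapLen A B z₀ ε θ < 0} ⊆ {θ | overlapLen A B z₀ ε' θ < 0} := by
  -- Were `z₀` common at level `ε`, it would be interior to both sets at level `ε'` and every ray
  -- would overlap there. Excluding it stops radii from degenerating to `0` in the limit.
  have hz₀ : z₀ ∉ pseudospectrum A ε ∩ pseudospectrum B ε := by
    intro hmem
    obtain ⟨θ, hθ⟩ := hex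
    have hev : ∀ᶠ r in 𝓝[>] (0 : ℝ), rayPoint z₀ θ r ∈
        interior (pseudospectrum A ε') ∩ interior (pseudospectrum B ε') := by
      refine (continuous_rayPoint_right.continuousAt.eventually
        ((isOpen_interior.inter isOpen_interior).mem_nhds ?_)).filter_mono nhdsWithin_le_nhds
      simp only [show rayPoint z₀ θ 0 = z₀ by simp [rayPoint]]
      exact ⟨pseudospectrum_subset_interior h hmem.1, pseudospectrum_subset_interior h hmem.2⟩
    obtain ⟨r, hr, hr0⟩ := (hev.and self_mem_nhdsWithin).exists
    exact hθ (overlapLen_neg_of_mem_interior hr0 hr.1 hr.2)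
  obtain ⟨R, -, hR⟩ := exists_overlapSlice_subset A B z₀ ε
  have hclosed : IsClosed {p : ℝ × ℝ | rayPoint z₀ p.1 p.2 ∈
      pseudospectrum A ε ∩ pseudospectrum B ε} :=
    ((isClosed_pseudospectrum A ε).inter (isClosed_pseudospectrum B ε)).preimage continuous_rayPoint
  -- Angles with a common point at some radius in the compact interval `[0, R]` form a closed set,
  -- being a projection along a compact factor.
  have hproj : IsClosed (Prod.fst '' {p : ℝ × Set.Icc 0 R | rayPoint z₀ p.1 p.2 ∈
      pseudospectrum A ε ∩ pseudospectrum B ε}) := by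
    apply isClosedMap_fst_of_compactSpace
    exact hclosed.preimage (f := fun p : ℝ × Set.Icc 0 R => ((p.1, (p.2 : ℝ)) : ℝ × ℝ))
      (by fun_prop)
  refine (closure_minimal ?_ hproj).trans ?_
  · intro θ hθ
    obtain ⟨r, hr⟩ := nonempty_of_measure_ne_zero (overlapLen_neg_iff_volume.mp hθ).ne'
    have := hR θ hr
    exact ⟨(θ, ⟨r, this.1.le, this.2.le⟩), hr.2, rfl⟩
  · rintro _ ⟨⟨θ, r, hr⟩, hmem, rfl⟩
    have hr0 : 0 < r := by
      refine lt_of_le_of_ne hr.1 fun h0 => hz₀ ?_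
      have : rayPoint z₀ θ r ∈ pseudospectrum A ε ∩ pseudospectrum B ε := hmem
      rwa [← h0, show rayPoint z₀ θ 0 = z₀ by simp [rayPoint]] at this
    exact overlapLen_neg_of_mem_interior hr0 (pseudospectrum_subset_interior h hmem.1)
      (pseudospectrum_subset_interior h hmem.2)

lemma volume_overlapSet_lt {ε' : ℝ} (hm : 0 < m) (hn : 0 < n) (hε : 0 ≤ ε) (hsep : sepD A B < ε)
    (h : ε < ε') (hlt : volume (overlapSet A B z₀ ε) < ENNReal.ofReal (2 * Real.pi)) :
    volume (overlapSet A B z₀ ε) < volume (overlapSet A B z₀ ε') := by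
  by_cases hex : ∃ θ, ¬ overlapLen A B z₀ ε' θ < 0
  swap
  · push Not at hex
    rwa [volume_overlapSet_of_forall hex]
  have hsub := closure_overlapLen_neg_subset h hex
  set P := {θ | overlapLen A B z₀ ε θ < 0} with hP
  set P' := {θ | overlapLen A B z₀ ε' θ < 0} with hP'
  have hP'o : IsOpen P' := isOpen_overlapLen_neg (hε.trans h.le)
  -- Otherwise `P'` is clopen in `ℝ`, hence empty or everything; `hsep` excludes the first and `hex`
  -- the second.
  obtain ⟨θ, hθ', hθ⟩ : ∃ θ ∈ P', θ ∉ closure P := by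
    by_contra! hcon
    have heq : closure P = P' := hsub.antisymm hcon
    have hclopen : IsClopen P' := ⟨heq ▸ isClosed_closure, hP'o⟩
    rcases isClopen_iff.mp hclopen with h0 | h1
    · have := (volume_overlapSet_pos_iff_sepD_lt hm hn (hε.trans h.le) (z₀ := z₀)).mpr
        (hsep.trans h)
      rw [overlapSet_eq, ← hP', h0] at this
      simp at this
    · obtain ⟨θ, hθ⟩ := hex
      exact hθ (h1 ▸ Set.mem_univ θ : θ ∈ P')
  obtain ⟨φ, hφ, k, hk, hshift⟩ := exists_mem_Ioc_overlapLen_eq A B z₀ θ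
  have hφP : φ ∉ closure P := by
    intro hmem
    apply hθ
    -- Translation by a period preserves `P`, hence its closure, so the escaping angle may be moved
    -- into `(-π, π]`.
    have hmaps : Set.MapsTo (fun x : ℝ => x + k * (2 * Real.pi)) P P := by
      intro x hx
      have := (periodic_overlapLen (A := A) (B := B) (z₀ := z₀) (ε := ε)).int_mul k x
      exact (this.trans_lt hx : _ < (0 : ℝ))
    have := hmaps.closure (by fun_prop) hmem
    simpa only [hk, sub_add_cancel] using this
  have hpos : 0 < volume ((P' \ closure P) ∩ Set.Ioc (-Real.pi) Real.pi) :=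
    volume_inter_Ioc_pos (hP'o.sdiff isClosed_closure)
      ⟨(by simpa [hP', hshift] using hθ'), hφP⟩ hφ
  have hdisj : Disjoint (overlapSet A B z₀ ε) ((P' \ closure P) ∩ Set.Ioc (-Real.pi) Real.pi) := by
    rw [Set.disjoint_left]
    rintro x hx ⟨⟨-, hx'⟩, -⟩
    exact hx' (subset_closure hx.2)
  have hmeas : MeasurableSet ((P' \ closure P) ∩ Set.Ioc (-Real.pi) Real.pi) :=
    (hP'o.measurableSet.diff isClosed_closure.measurableSet).inter measurableSet_Ioc
  calc volume (overlapSet A B z₀ ε)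
      < volume (overlapSet A B z₀ ε) +
        volume ((P' \ closure P) ∩ Set.Ioc (-Real.pi) Real.pi) :=
        ENNReal.lt_add_right (hlt.trans ENNReal.ofReal_lt_top).ne hpos.ne'
    _ = volume (overlapSet A B z₀ ε ∪ ((P' \ closure P) ∩ Set.Ioc (-Real.pi) Real.pi)) :=
        (measure_union hdisj hmeas).symm
    _ ≤ volume (overlapSet A B z₀ ε') := by
        refine measure_mono (Set.union_subset (overlapSet_mono h.le) ?_)
        rintro x ⟨⟨hx, -⟩, hx'⟩
        exact ⟨hx', hx⟩

end Overlap

/-! ### The boundary of a pseudospectrum near a simple eigenvalue of the pencil. -/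

section BoundaryCurve

/-- Local form of the implicit function theorem that also records the sign of the function on both
sides of its zero curve. -/
lemma exists_zero_curve_with_sign {q : ℝ × ℝ → ℝ} (hq : ContDiff ℝ 1 q) {u : ℝ × ℝ} (hu : q u = 0)
    {c : ℝ} (hc : 0 < c) (hder : HasDerivAt (fun s => q (u.1, s)) c u.2) :
    ∃ ρ : ℝ → ℝ, DifferentiableAt ℝ ρ u.1 ∧ ρ u.1 = u.2 ∧
      ∀ᶠ v in 𝓝 u, (0 < q v ↔ ρ v.1 < v.2) ∧ (q v = 0 ↔ v.2 = ρ v.1) := by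
  have hs : HasStrictFDerivAt q (fderiv ℝ q u) u :=
    hq.contDiffAt.hasStrictFDerivAt one_ne_zero
  set L := fderiv ℝ q u with hL
  have hLc : L (0, 1) = c := by
    have h1 : HasDerivAt (fun s : ℝ => (u.1, s)) ((0 : ℝ), (1 : ℝ)) u.2 :=
      (hasDerivAt_const u.2 u.1).prodMk (hasDerivAt_id u.2)
    have h2 : HasFDerivAt q L ((fun s : ℝ => (u.1, s)) u.2) := hs.hasFDerivAt
    exact (h2.comp_hasDerivAt u.2 h1).unique hder
  have hLt (t : ℝ) : L (0, t) = c * t := by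
    have : ((0 : ℝ), t) = t • ((0 : ℝ), (1 : ℝ)) := by simp
    rw [this, map_smul, hLc, smul_eq_mul, mul_comm]
  have hinv : (L ∘L .inr ℝ ℝ ℝ).IsInvertible := by
    refine ⟨ContinuousLinearEquiv.unitsEquivAut ℝ (Units.mk0 c hc.ne'), ?_⟩
    ext
    simp [hLc]
  refine ⟨hs.implicitFunctionOfProdDomain hinv,
    (hs.hasStrictFDerivAt_implicitFunctionOfProdDomain hinv).differentiableAt,
    (hs.eventually_apply_eq_iff_implicitFunctionOfProdDomain hinv).self_of_nhds.mp rfl, ?_⟩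
  set ρ := hs.implicitFunctionOfProdDomain hinv
  have hρ0 : ∀ᶠ v in 𝓝 u, q (v.1, ρ v.1) = 0 := by
    have := hs.eventually_apply_implicitFunctionOfProdDomain hinv
    rw [hu] at this
    exact continuousAt_fst.eventually this
  have htend : Tendsto (fun v : ℝ × ℝ => (v, (v.1, ρ v.1))) (𝓝 u) (𝓝 (u, u)) := by
    have h1 : Tendsto (fun v : ℝ × ℝ => ρ v.1) (𝓝 u) (𝓝 u.2) :=
      (hs.tendsto_implicitFunctionOfProdDomain hinv).comp continuousAt_fst
    exact tendsto_id.prodMk_nhds ((continuousAt_fst (p := u)).tendsto.prodMk_nhds h1)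
  -- Comparing `v` with the point of the zero curve on the same vertical line, strict
  -- differentiability gives `q v = c * (v.2 - ρ v.1)` up to half that size, which fixes the sign.
  have hest := htend.eventually (hs.isLittleO.def (half_pos hc))
  filter_upwards [hest, hρ0] with v hv h0
  have hsub : v - (v.1, ρ v.1) = (0, v.2 - ρ v.1) := by ext <;> simp
  simp only [hsub, hLt, h0, sub_zero] at hv
  rw [Prod.norm_def] at hv
  simp only [norm_zero, Real.norm_eq_abs] at hv
  rw [max_eq_right (abs_nonneg _)] at hv
  have hv' := abs_le.mp hv
  rcases lt_trichotomy v.2 (ρ v.1) with h | h | h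
  · rw [abs_of_neg (by linarith)] at hv'
    have hneg : c * (v.2 - ρ v.1) < 0 := mul_neg_of_pos_of_neg hc (by linarith)
    have : q v < 0 := by linarith
    exact ⟨⟨fun h' => absurd h' this.not_gt, fun h' => absurd h' h.not_gt⟩,
      ⟨fun h' => absurd h' this.ne, fun h' => absurd h' h.ne⟩⟩
  · have : q v = 0 := by
      rw [h] at hv'
      simp at hv'
      linarith
    exact ⟨⟨fun h' => absurd this h'.ne', fun h' => absurd h h'.ne'⟩, ⟨fun _ => h, fun _ => this⟩⟩
  · rw [abs_of_pos (by linarith)] at hv'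
    have hpos : 0 < c * (v.2 - ρ v.1) := mul_pos hc (by linarith)
    have : 0 < q v := by linarith
    exact ⟨⟨fun _ => h, fun _ => this⟩, ⟨fun h' => absurd h' this.ne', fun h' => absurd h' h.ne'⟩⟩

variable {m n : ℕ} {A : Matrix (Fin m) (Fin m) ℂ} {B : Matrix (Fin n) (Fin n) ℂ}
  {ε : ℝ} {z z₀ : ℂ} {θ r : ℝ}

lemma mem_interior_of_eventually_rayPoint_mem {S : Set ℂ} (hr : 0 < r)
    (h : ∀ᶠ p : ℝ × ℝ in 𝓝 (θ, r), rayPoint z₀ p.1 p.2 ∈ S) : rayPoint z₀ θ r ∈ interior S := by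
  rw [mem_interior_iff_mem_nhds]
  set w := rayPoint z₀ θ r with hw
  -- A polar-coordinate inverse of `rayPoint`, rotated so that `arg` is evaluated near the positive
  -- axis, away from its branch cut.
  let g : ℂ → ℝ × ℝ := fun z =>
    (θ + ((z - z₀) * Complex.exp (-(θ * Complex.I))).arg, ‖z - z₀‖)
  have hexp : Complex.exp (θ * Complex.I) * Complex.exp (-(θ * Complex.I)) = 1 := by
    rw [← Complex.exp_add, add_neg_cancel, Complex.exp_zero]
  have hval : (w - z₀) * Complex.exp (-(θ * Complex.I)) = r := by
    rw [hw, rayPoint, add_sub_cancel_left, mul_assoc, hexp, mul_one]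
  have hgw : g w = (θ, r) := by
    have hn : ‖w - z₀‖ = r := by rw [hw, norm_rayPoint_sub, abs_of_pos hr]
    simp only [g, hval, hn, Complex.arg_ofReal_of_nonneg hr.le, add_zero]
  have hgc : ContinuousAt g w := by
    refine ContinuousAt.prodMk (continuousAt_const.add ?_) (by fun_prop)
    refine ContinuousAt.comp (f := fun z => (z - z₀) * Complex.exp (-(θ * Complex.I)))
      (g := Complex.arg) (x := w) ?_ (by fun_prop)
    rw [hval]
    exact Complex.continuousAt_arg (Complex.ofReal_mem_slitPlane.mpr hr)
  have hg (z : ℂ) : rayPoint z₀ (g z).1 (g z).2 = z := by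
    have hn : ‖z - z₀‖ = ‖(z - z₀) * Complex.exp (-(θ * Complex.I))‖ := by
      rw [norm_mul, show -(θ * Complex.I) = ((-θ : ℝ) : ℂ) * Complex.I by push_cast; ring,
        Complex.norm_exp_ofReal_mul_I, mul_one]
    simp only [g, rayPoint]
    rw [Complex.ofReal_add, add_mul, Complex.exp_add, hn, mul_left_comm,
      Complex.norm_mul_exp_arg_mul_I, mul_comm (Complex.exp _), mul_assoc,
      mul_comm (Complex.exp (-_)), hexp]
    ring
  have := hgc.eventually (hgw ▸ h)
  filter_upwards [this] with z hz
  rwa [hg] at hz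

lemma mem_iff_mem_of_isPreconnected {S T : Set ℂ} (hT : IsPreconnected T)
    (hTS : ∀ x ∈ T, x ∉ frontier S) {x y : ℂ} (hx : x ∈ T) (hy : y ∈ T) : x ∈ S ↔ y ∈ S := by
  have key {x y : ℂ} (hx : x ∈ T) (hy : y ∈ T) (hxS : x ∈ S) : y ∈ S := by
    by_contra hyS
    have hint {w : ℂ} (hw : w ∈ T) (hwc : w ∈ closure S) : w ∈ interior S := by
      by_contra h
      exact hTS w hw ⟨hwc, h⟩
    obtain ⟨w, -, hwi, hwc⟩ := hT (interior S) (closure S)ᶜ isOpen_interior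
      isClosed_closure.isOpen_compl
      (fun w hw => (em (w ∈ closure S)).imp (hint hw) id)
      ⟨x, hx, hint hx (subset_closure hxS)⟩
      ⟨y, hy, fun h => hyS (interior_subset (hint hy h))⟩
    exact hwc (subset_closure (interior_subset hwi))
  exact ⟨key hx hy, key hy hx⟩

/-- Near a boundary point at which `ir` is a simple eigenvalue of the pencil, the pseudospectrum is
one side of a differentiable curve. -/
lemma exists_boundary_curve (hε : 0 ≤ ε) (hr : 0 < r)
    (hfr : rayPoint z₀ θ r ∈ frontier (pseudospectrum A ε))
    (hsimple : IsSimplePencilEigenvalue (pencilC A z₀ ε) (pencilD m θ) (Complex.I * r)) :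
    ∃ (ρ : ℝ → ℝ) (e : ℝ), (e = 1 ∨ e = -1) ∧ DifferentiableAt ℝ ρ θ ∧ ρ θ = r ∧
      ∀ᶠ p : ℝ × ℝ in 𝓝 (θ, r),
        (rayPoint z₀ p.1 p.2 ∈ pseudospectrum A ε ↔ e * (p.2 - ρ p.1) ≤ 0) := by
  set q : ℝ × ℝ → ℝ := fun p => gramDet A ε (rayPoint z₀ p.1 p.2) with hq
  have hqc : ContDiff ℝ 1 q := contDiff_gramDet_rayPoint A z₀ ε
  have hq0 : q (θ, r) = 0 := gramDet_eq_zero_of_mem_frontier hε hfr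
  obtain ⟨c, hc, hder⟩ := exists_hasDerivAt_gramDet_ne_zero hε hsimple
  obtain ⟨ρ, e, he, hρ, hρr, hev⟩ : ∃ (ρ : ℝ → ℝ) (e : ℝ), (e = 1 ∨ e = -1) ∧
      DifferentiableAt ℝ ρ θ ∧ ρ θ = r ∧ ∀ᶠ p in 𝓝 (θ, r),
        (0 < q p ↔ 0 < e * (p.2 - ρ p.1)) := by
    rcases lt_or_gt_of_ne hc with hc | hc
    · obtain ⟨ρ, hρ, hρr, hev⟩ := exists_zero_curve_with_sign (q := fun p => -q p) (u := (θ, r))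
        hqc.neg (by simp [hq0]) (neg_pos.mpr hc) hder.neg
      refine ⟨ρ, -1, Or.inr rfl, hρ, hρr, ?_⟩
      filter_upwards [hev] with p ⟨h1, h2⟩
      rw [neg_eq_zero] at h2
      constructor
      · intro hpos
        have h3 : ¬ ρ p.1 < p.2 := fun h => by have := h1.mpr h; linarith
        have h4 : p.2 ≠ ρ p.1 := fun h => hpos.ne' (h2.mpr h)
        have := lt_of_le_of_ne (not_lt.mp h3) h4
        linarith
      · intro hpos
        have h3 : p.2 < ρ p.1 := by linarith
        have h4 : q p ≠ 0 := fun h => h3.ne (h2.mp h)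
        have h5 : ¬ 0 < -q p := fun h => h3.not_gt (h1.mp h)
        exact lt_of_le_of_ne (by linarith) h4.symm
    · obtain ⟨ρ, hρ, hρr, hev⟩ := exists_zero_curve_with_sign (u := (θ, r)) hqc hq0 hc hder
      refine ⟨ρ, 1, Or.inl rfl, hρ, hρr, ?_⟩
      filter_upwards [hev] with p ⟨h1, _⟩
      rw [one_mul, sub_pos, h1]
  refine ⟨ρ, e, he, hρ, hρr, ?_⟩
  have hout {p : ℝ × ℝ} (hp : rayPoint z₀ p.1 p.2 ∉ pseudospectrum A ε) : 0 < q p :=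
    gramDet_pos hε hp
  have hnf {p : ℝ × ℝ} (hp : 0 < q p) : rayPoint z₀ p.1 p.2 ∉ frontier (pseudospectrum A ε) :=
    fun h => hp.ne' (gramDet_eq_zero_of_mem_frontier hε h)
  obtain ⟨δ, hδ, hball⟩ := Metric.eventually_nhds_iff.mp hev
  have habs : |e| = 1 := by rcases he with rfl | rfl <;> simp
  have hee : e * e = 1 := by rcases he with rfl | rfl <;> simp
  -- A radius strictly on the side where `q` is positive, for all angles near `θ`. Positivity of `q`
  -- alone does not mean lying outside the pseudospectrum, so points of this side are joined to `(θ,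
  -- s)`, vertically and then along the row, without meeting the frontier.
  set s := r + e * (δ / 2) with hs
  have hcont : ∀ᶠ φ in 𝓝 θ, 0 < e * (s - ρ φ) := by
    have hct : ContinuousAt (fun φ => e * (s - ρ φ)) θ :=
      continuousAt_const.mul (continuousAt_const.sub hρ.continuousAt)
    refine hct.eventually (lt_mem_nhds ?_)
    change 0 < e * (s - ρ θ)
    rw [hρr, hs, add_sub_cancel_left, ← mul_assoc, hee]
    linarith
  obtain ⟨δ', hδ', hcont⟩ := Metric.eventually_nhds_iff.mp hcont
  set η := min δ δ' with hη
  have hηpos : 0 < η := lt_min hδ hδ'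
  have hsδ : |s - r| < δ := by
    rw [hs, add_sub_cancel_left, abs_mul, habs, one_mul, abs_of_pos (by linarith)]
    linarith
  have hpos {φ t : ℝ} (hφ : |φ - θ| < η) (ht : |t - r| < δ) : 0 < q (φ, t) ↔ 0 < e * (t - ρ φ) := by
    refine hball ?_
    rw [Prod.dist_eq, max_lt_iff, Real.dist_eq, Real.dist_eq]
    exact ⟨hφ.trans_le (min_le_left _ _), ht⟩
  have hsq {φ : ℝ} (hφ : |φ - θ| < η) : 0 < q (φ, s) :=
    (hpos hφ hsδ).mpr (hcont (by rw [Real.dist_eq]; exact hφ.trans_le (min_le_right _ _)))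
  have hrow {φ : ℝ} (hφ : |φ - θ| < η) :
      rayPoint z₀ φ s ∈ pseudospectrum A ε ↔ rayPoint z₀ θ s ∈ pseudospectrum A ε := by
    have hpre : IsPreconnected ((fun ψ => rayPoint z₀ ψ s) '' Metric.ball θ η) :=
      (convex_ball θ η).isPreconnected.image _ (by unfold rayPoint; fun_prop)
    refine mem_iff_mem_of_isPreconnected hpre ?_ ⟨φ, by rwa [Metric.mem_ball, Real.dist_eq], rfl⟩
      ⟨θ, Metric.mem_ball_self hηpos, rfl⟩
    rintro _ ⟨ψ, hψ, rfl⟩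
    rw [Metric.mem_ball, Real.dist_eq] at hψ
    exact hnf (hsq hψ)
  have hcol {φ t : ℝ} (hφ : |φ - θ| < η) (ht : |t - r| < δ) (hq : 0 < q (φ, t)) :
      rayPoint z₀ φ t ∈ pseudospectrum A ε ↔ rayPoint z₀ φ s ∈ pseudospectrum A ε := by
    have hpre : IsPreconnected ((fun x => rayPoint z₀ φ x) '' Set.uIcc t s) :=
      isPreconnected_uIcc.image _ continuous_rayPoint_right.continuousOn
    refine mem_iff_mem_of_isPreconnected hpre ?_ ⟨t, Set.left_mem_uIcc, rfl⟩
      ⟨s, Set.right_mem_uIcc, rfl⟩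
    rintro _ ⟨x, hx, rfl⟩
    have h1 := (hpos hφ ht).mp hq
    have h2 := (hpos hφ hsδ).mp (hsq hφ)
    rw [abs_lt] at ht
    have hsδ' := abs_lt.mp hsδ
    refine hnf (p := (φ, x)) ((hpos hφ ?_).mpr ?_)
    · rw [abs_lt]
      rcases Set.mem_uIcc.mp hx with h | h <;> constructor <;> linarith [h.1, h.2]
    · rcases he with rfl | rfl <;> rcases Set.mem_uIcc.mp hx with h | h <;> linarith [h.1, h.2]
  have hbox : ∀ᶠ p : ℝ × ℝ in 𝓝 (θ, r), |p.1 - θ| < η ∧ |p.2 - r| < δ := by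
    filter_upwards [prod_mem_nhds (Metric.ball_mem_nhds θ hηpos) (Metric.ball_mem_nhds r hδ)]
      with p hp
    simpa only [Set.mem_prod, Metric.mem_ball, Real.dist_eq] using hp
  -- If the positive side lay inside, a whole neighbourhood would, since points with `q ≤ 0` always
  -- do; this contradicts being a frontier point.
  have hs_out : rayPoint z₀ θ s ∉ pseudospectrum A ε := by
    intro hmem
    have : rayPoint z₀ θ r ∈ interior (pseudospectrum A ε) := by
      refine mem_interior_of_eventually_rayPoint_mem hr ?_
      filter_upwards [hbox] with p hp
      by_contra hnot
      have hqp := hout hnot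
      exact hnot ((hcol hp.1 hp.2 hqp).mpr ((hrow hp.1).mpr hmem))
    exact hfr.2 this
  filter_upwards [hbox] with p hp
  rw [← not_lt, ← hpos hp.1 hp.2]
  constructor
  · intro hmem hqp
    exact hs_out ((hrow hp.1).mp ((hcol hp.1 hp.2 hqp).mp hmem))
  · intro hqp
    by_contra hnot
    exact hqp (hout hnot)

end BoundaryCurve

/-! ### Differentiability of the overlap length. -/

section Differentiability

/-- If a family of sets is locally constant away from finitely many points, near which its measure
depends differentiably on the parameter, then its measure is differentiable. -/
lemma differentiableAt_measureReal_inter_Ioc {S : ℝ → Set ℝ} {θ R : ℝ} (Z : Finset ℝ)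
    (hS : ∀ φ, MeasurableSet (S φ)) (hZ : ∀ x ∈ Z, 0 < x ∧ x < R)
    (hreg : ∀ x ∈ Set.Icc 0 R, x ∉ Z → ∀ᶠ p : ℝ × ℝ in 𝓝 (θ, x), (p.2 ∈ S p.1 ↔ p.2 ∈ S θ))
    (hloc : ∀ x ∈ Z, ∀ᶠ δ in 𝓝[>] (0 : ℝ),
      DifferentiableAt ℝ (fun φ => volume.real (S φ ∩ Set.Ioo (x - δ) (x + δ))) θ) :
    DifferentiableAt ℝ (fun φ => volume.real (S φ ∩ Set.Ioc 0 R)) θ := by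
  have hsmall {a : ℝ} (ha : 0 < a) : ∀ᶠ δ in 𝓝[>] (0 : ℝ), δ < a :=
    nhdsWithin_le_nhds (gt_mem_nhds ha)
  -- One `δ` for all exceptional points: the windows are pairwise disjoint, lie inside `(0, R)`, and
  -- have differentiable measure.
  obtain ⟨δ, ⟨⟨hδ0, hδl⟩, hδb⟩, hδs⟩ : ∃ δ : ℝ, ((0 < δ ∧ ∀ x ∈ Z,
      DifferentiableAt ℝ (fun φ => volume.real (S φ ∩ Set.Ioo (x - δ) (x + δ))) θ) ∧
      (∀ x ∈ Z, δ < x ∧ δ < R - x)) ∧ ∀ x ∈ Z, ∀ y ∈ Z, x ≠ y → δ < |x - y| / 2 := by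
    refine Eventually.exists (f := 𝓝[>] (0 : ℝ)) (((Eventually.and self_mem_nhdsWithin ?_).and
      ?_).and ?_)
    · exact (Finset.eventually_all Z).mpr hloc
    · exact (Finset.eventually_all Z).mpr fun x hx =>
        (hsmall (hZ x hx).1).and (hsmall (sub_pos.mpr (hZ x hx).2))
    · refine (Finset.eventually_all Z).mpr fun x _ => (Finset.eventually_all Z).mpr fun y _ => ?_
      by_cases hxy : x = y
      · exact Eventually.of_forall fun _ h => absurd hxy h
      · filter_upwards [hsmall (half_pos (abs_pos.mpr (sub_ne_zero.mpr hxy)))] with δ h _ using h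
  set U : Set ℝ := ⋃ x ∈ Z, Set.Ioo (x - δ) (x + δ) with hU
  have hUo : IsOpen U := isOpen_biUnion fun _ _ => isOpen_Ioo
  have hUsub : U ⊆ Set.Ioc 0 R := by
    refine Set.iUnion₂_subset fun x hx y hy => ?_
    have := hδb x hx
    exact ⟨by linarith [hy.1], by linarith [hy.2]⟩
  have hsplit (φ : ℝ) : volume.real (S φ ∩ Set.Ioc 0 R) =
      ∑ x ∈ Z, volume.real (S φ ∩ Set.Ioo (x - δ) (x + δ)) +
        volume.real ((S φ ∩ Set.Ioc 0 R) \ U) := by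
    have hfin : volume (S φ ∩ Set.Ioc 0 R) ≠ ⊤ :=
      ((measure_mono Set.inter_subset_right).trans_lt measure_Ioc_lt_top).ne
    rw [← measureReal_inter_add_sdiff (s := S φ ∩ Set.Ioc 0 R) hUo.measurableSet hfin]
    congr 1
    have hinter : S φ ∩ Set.Ioc 0 R ∩ U = ⋃ x ∈ Z, S φ ∩ Set.Ioo (x - δ) (x + δ) := by
      rw [Set.inter_assoc, Set.inter_eq_right.mpr hUsub, hU, Set.inter_iUnion₂]
    rw [hinter, measureReal_biUnion_finset ?_ ?_ ?_]
    · intro x hx y hy hxy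
      refine Disjoint.mono Set.inter_subset_right Set.inter_subset_right ?_
      rw [Set.disjoint_left]
      intro t ht ht'
      have h1 := hδs x hx y hy hxy
      have h2 : |x - y| < 2 * δ := by
        rw [abs_lt]; constructor <;> linarith [ht.1, ht.2, ht'.1, ht'.2]
      linarith
    · exact fun x _ => (hS φ).inter measurableSet_Ioo
    · exact fun x _ => ((measure_mono Set.inter_subset_right).trans_lt measure_Ioo_lt_top).ne
  have hK : IsCompact (Set.Icc 0 R \ U) := isCompact_Icc.diff hUo
  -- Compactness of the complement of the windows makes the local constancy uniform in the angle, so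
  -- that part contributes a constant.
  have hconst : ∀ᶠ φ in 𝓝 θ, ∀ x ∈ Set.Icc 0 R \ U, (x ∈ S φ ↔ x ∈ S θ) := by
    refine hK.eventually_forall_of_forall_eventually fun x hx => ?_
    refine hreg x hx.1 fun hxZ => hx.2 ?_
    exact Set.mem_biUnion hxZ ⟨by linarith, by linarith⟩
  have hcongr : (fun φ => volume.real (S φ ∩ Set.Ioc 0 R)) =ᶠ[𝓝 θ] fun φ =>
      ∑ x ∈ Z, volume.real (S φ ∩ Set.Ioo (x - δ) (x + δ)) +
        volume.real ((S θ ∩ Set.Ioc 0 R) \ U) := by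
    filter_upwards [hconst] with φ hφ
    rw [hsplit φ]
    congr 2
    ext x
    constructor
    · rintro ⟨⟨h1, h2⟩, h3⟩
      exact ⟨⟨(hφ x ⟨Set.Ioc_subset_Icc_self h2, h3⟩).mp h1, h2⟩, h3⟩
    · rintro ⟨⟨h1, h2⟩, h3⟩
      exact ⟨⟨(hφ x ⟨Set.Ioc_subset_Icc_self h2, h3⟩).mpr h1, h2⟩, h3⟩
  refine (DifferentiableAt.add_const _ ?_).congr_of_eventuallyEq hcongr
  exact DifferentiableAt.fun_sum fun x hx => hδl x hx

lemma volume_real_Ioo_inter_halfline {x y δ e : ℝ} (he : e = 1 ∨ e = -1) (hy : |y - x| < δ) :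
    volume.real {t | t ∈ Set.Ioo (x - δ) (x + δ) ∧ e * (t - y) ≤ 0} = δ + e * (y - x) := by
  rw [abs_lt] at hy
  rcases he with rfl | rfl
  · have : {t | t ∈ Set.Ioo (x - δ) (x + δ) ∧ 1 * (t - y) ≤ 0} = Set.Ioc (x - δ) y := by
      ext t
      simp only [Set.mem_ofPred_eq, Set.mem_Ioo, Set.mem_Ioc]
      constructor
      · rintro ⟨⟨h1, h2⟩, h3⟩; constructor <;> linarith
      · rintro ⟨h1, h2⟩; exact ⟨⟨by linarith, by linarith⟩, by linarith⟩
    rw [this, Real.volume_real_Ioc_of_le (by linarith)]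
    ring
  · have : {t | t ∈ Set.Ioo (x - δ) (x + δ) ∧ -1 * (t - y) ≤ 0} = Set.Ico y (x + δ) := by
      ext t
      simp only [Set.mem_ofPred_eq, Set.mem_Ioo, Set.mem_Ico]
      constructor
      · rintro ⟨⟨h1, h2⟩, h3⟩; constructor <;> linarith
      · rintro ⟨h1, h2⟩; exact ⟨⟨by linarith, by linarith⟩, by linarith⟩
    rw [this, Real.volume_real_Ico_of_le (by linarith)]
    ring

variable {m n : ℕ} {A : Matrix (Fin m) (Fin m) ℂ} {B : Matrix (Fin n) (Fin n) ℂ}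
  {ε : ℝ} {z z₀ : ℂ} {θ r : ℝ}

/-- Here `T` plays the other pseudospectrum, locally constant at this point: the window contributes
`δ + e * (ρ φ - r)` if the point lies in `T`, and nothing otherwise. -/
lemma eventually_differentiableAt_measureReal_near_boundary (hε : 0 ≤ ε) {T : Set ℂ} (hr : 0 < r)
    (hfr : rayPoint z₀ θ r ∈ frontier (pseudospectrum A ε))
    (hT : rayPoint z₀ θ r ∉ frontier T)
    (hsimple : IsSimplePencilEigenvalue (pencilC A z₀ ε) (pencilD m θ) (Complex.I * r)) :
    ∀ᶠ δ in 𝓝[>] (0 : ℝ), DifferentiableAt ℝ (fun φ => volume.real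
      ({t | rayPoint z₀ φ t ∈ pseudospectrum A ε ∩ T} ∩ Set.Ioo (r - δ) (r + δ))) θ := by
  obtain ⟨ρ, e, he, hρ, hρr, hev⟩ := exists_boundary_curve hε hr hfr hsimple
  obtain ⟨η, hη, hball⟩ := Metric.eventually_nhds_iff.mp (hev.and (eventually_rayPoint_mem_iff hT))
  filter_upwards [self_mem_nhdsWithin, nhdsWithin_le_nhds (gt_mem_nhds hη)] with δ hδ hδη
  have hδ : 0 < δ := hδ
  have hloc {φ t : ℝ} (hφ : dist φ θ < η) (ht : t ∈ Set.Ioo (r - δ) (r + δ)) :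
      (rayPoint z₀ φ t ∈ pseudospectrum A ε ↔ e * (t - ρ φ) ≤ 0) ∧
        (rayPoint z₀ φ t ∈ T ↔ rayPoint z₀ θ r ∈ T) := by
    refine hball (y := (φ, t)) ?_
    rw [Prod.dist_eq, max_lt_iff]
    refine ⟨hφ, ?_⟩
    rw [Real.dist_eq, abs_lt]
    constructor <;> linarith [ht.1, ht.2]
  have hnear : ∀ᶠ φ in 𝓝 θ, dist φ θ < η := Metric.ball_mem_nhds θ hη
  by_cases hmem : rayPoint z₀ θ r ∈ T
  · have hρnear : ∀ᶠ φ in 𝓝 θ, |ρ φ - r| < δ := by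
      have := hρ.continuousAt.eventually (Metric.ball_mem_nhds _ hδ)
      simpa only [Metric.mem_ball, Real.dist_eq, hρr] using this
    have hcongr : (fun φ => volume.real
        ({t | rayPoint z₀ φ t ∈ pseudospectrum A ε ∩ T} ∩ Set.Ioo (r - δ) (r + δ))) =ᶠ[𝓝 θ]
        fun φ => δ + e * (ρ φ - r) := by
      filter_upwards [hnear, hρnear] with φ h1 h2
      rw [← volume_real_Ioo_inter_halfline he h2]
      congr 1
      ext t
      constructor
      · rintro ⟨ht, ht'⟩
        exact ⟨ht', (hloc h1 ht').1.mp ht.1⟩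
      · rintro ⟨ht', ht⟩
        exact ⟨⟨(hloc h1 ht').1.mpr ht, (hloc h1 ht').2.mpr hmem⟩, ht'⟩
    exact (((hρ.sub_const r).const_mul e).const_add δ).congr_of_eventuallyEq hcongr
  · have hcongr : (fun φ => volume.real
        ({t | rayPoint z₀ φ t ∈ pseudospectrum A ε ∩ T} ∩ Set.Ioo (r - δ) (r + δ))) =ᶠ[𝓝 θ]
        fun _ => (0 : ℝ) := by
      filter_upwards [hnear] with φ h1
      have : {t | rayPoint z₀ φ t ∈ pseudospectrum A ε ∩ T} ∩ Set.Ioo (r - δ) (r + δ) = ∅ := by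
        refine Set.eq_empty_of_forall_notMem ?_
        rintro t ⟨ht, ht'⟩
        exact hmem ((hloc h1 ht').2.mp ht.2)
      rw [this, measureReal_empty]
    exact (differentiableAt_const _).congr_of_eventuallyEq hcongr

lemma differentiableAt_overlapLen (hε : 0 ≤ ε) (hzA : z₀ ∉ frontier (pseudospectrum A ε))
    (hzB : z₀ ∉ frontier (pseudospectrum B ε)) (hA : SimpleOnRay A z₀ ε θ)
    (hB : SimpleOnRay B z₀ ε θ)
    (hdisj : ray z₀ θ ∩ frontier (pseudospectrum A ε) ∩ frontier (pseudospectrum B ε) = ∅) :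
    DifferentiableAt ℝ (overlapLen A B z₀ ε) θ := by
  obtain ⟨RA, -, hltA⟩ := exists_pos_forall_rayPoint_mem A z₀ ε
  obtain ⟨RB, -, hltB⟩ := exists_pos_forall_rayPoint_mem B z₀ ε
  set R' := max RA RB
  set S : ℝ → Set ℝ := fun φ => {t | rayPoint z₀ φ t ∈ pseudospectrum A ε ∩ pseudospectrum B ε}
    with hS
  have hslice : overlapLen A B z₀ ε = fun φ => -volume.real (S φ ∩ Set.Ioc 0 R') := by
    funext φ
    rw [overlapLen_eq, measureReal_def]
    congr 3
    ext t
    constructor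
    · rintro ⟨h0, ht⟩
      exact ⟨ht, h0, (hltA _ _ ht.1).le.trans (le_max_left _ _)⟩
    · rintro ⟨ht, h0, -⟩
      exact ⟨h0, ht⟩
  rw [hslice]
  refine DifferentiableAt.neg ?_
  have hfA : {t : ℝ | 0 < t ∧ rayPoint z₀ θ t ∈ frontier (pseudospectrum A ε)}.Finite :=
    (finite_setOf_rayPoint_mem_frontier hε A z₀ θ).subset fun _ h => h.2
  have hfB : {t : ℝ | 0 < t ∧ rayPoint z₀ θ t ∈ frontier (pseudospectrum B ε)}.Finite :=
    (finite_setOf_rayPoint_mem_frontier hε B z₀ θ).subset fun _ h => h.2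
  have hnotboth {t : ℝ} (ht : 0 < t) (h1 : rayPoint z₀ θ t ∈ frontier (pseudospectrum A ε))
      (h2 : rayPoint z₀ θ t ∈ frontier (pseudospectrum B ε)) : False := by
    have : rayPoint z₀ θ t ∈ ray z₀ θ ∩ frontier (pseudospectrum A ε) ∩
      frontier (pseudospectrum B ε) := ⟨⟨⟨t, ht, rfl⟩, h1⟩, h2⟩
    rw [hdisj] at this
    exact this
  refine differentiableAt_measureReal_inter_Ioc (hfA.union hfB).toFinset ?_ ?_ ?_ ?_
  · intro φ
    exact (((isClosed_pseudospectrum A ε).inter (isClosed_pseudospectrum B ε)).preimage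
      continuous_rayPoint_right).measurableSet
  · intro x hx
    rw [Set.Finite.mem_toFinset] at hx
    rcases hx with ⟨h0, hx⟩ | ⟨h0, hx⟩
    · exact ⟨h0, (hltA _ _ ((isClosed_pseudospectrum A ε).frontier_subset hx)).trans_le
        (le_max_left _ _)⟩
    · exact ⟨h0, (hltB _ _ ((isClosed_pseudospectrum B ε).frontier_subset hx)).trans_le
        (le_max_right _ _)⟩
  · intro x hx hxZ
    rw [Set.Finite.mem_toFinset] at hxZ
    have hxfr : rayPoint z₀ θ x ∉ frontier (pseudospectrum A ε) ∧
        rayPoint z₀ θ x ∉ frontier (pseudospectrum B ε) := by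
      -- Radius `0` is not on the open ray; there the hypothesis on `z₀` replaces membership in the
      -- exceptional set.
      rcases hx.1.eq_or_lt with h0 | h0
      · rw [← h0, show rayPoint z₀ θ 0 = z₀ by simp [rayPoint]]
        exact ⟨hzA, hzB⟩
      · exact ⟨fun h => hxZ (Or.inl ⟨h0, h⟩), fun h => hxZ (Or.inr ⟨h0, h⟩)⟩
    have hcl : ∀ᶠ p : ℝ × ℝ in 𝓝 (θ, x), (p.2 ∈ S p.1 ↔ x ∈ S θ) := by
      filter_upwards [eventually_rayPoint_mem_iff hxfr.1, eventually_rayPoint_mem_iff hxfr.2]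
        with p h1 h2
      exact and_congr h1 h2
    -- Membership of `p.2` is compared at the angles `p.1` and `θ` by relating both to the value at
    -- `(θ, x)`.
    have ht : Tendsto (fun p : ℝ × ℝ => (θ, p.2)) (𝓝 (θ, x)) (𝓝 (θ, x)) :=
      (by fun_prop : Continuous fun p : ℝ × ℝ => (θ, p.2)).tendsto' _ _ rfl
    filter_upwards [hcl, ht.eventually hcl] with p h1 h2
    rw [h1, h2]
  · intro x hx
    rw [Set.Finite.mem_toFinset] at hx
    rcases hx with ⟨h0, hx⟩ | ⟨h0, hx⟩
    · exact eventually_differentiableAt_measureReal_near_boundary hε h0 hx (hnotboth h0 hx)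
        (hA x h0 hx).1
    · have := eventually_differentiableAt_measureReal_near_boundary hε h0 hx
        (fun h => hnotboth h0 h hx) (hB x h0 hx).1
      simpa only [hS, Set.inter_comm (pseudospectrum A ε)] using this

end Differentiability

end SepLambda

theorem mainTheorem2 {m n : ℕ} (hm : 0 < m) (hn : 0 < n)
    (A : Matrix (Fin m) (Fin m) ℂ) (B : Matrix (Fin n) (Fin n) ℂ) (z₀ : ℂ) :
    (∀ ε : ℝ, 0 ≤ ε →
      -- (i)
      (∀ θ : ℝ, SepLambda.overlapLen A B z₀ ε θ < 0 ↔
        (SepLambda.ray z₀ θ ∩ interior (SepLambda.pseudospectrum A ε) ∩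
          interior (SepLambda.pseudospectrum B ε)).Nonempty) ∧
      -- (ii)
      (∀ θ : ℝ, 0 < SepLambda.argMin A z₀ ε θ + SepLambda.argMin B z₀ ε θ →
        SepLambda.overlapLen A B z₀ ε θ = 0) ∧
      -- (iii)
      Continuous (SepLambda.overlapLen A B z₀ ε) ∧
      -- (iv)
      (z₀ ∉ frontier (SepLambda.pseudospectrum A ε) →
        z₀ ∉ frontier (SepLambda.pseudospectrum B ε) →
        ∀ θ : ℝ, SepLambda.SimpleOnRay A z₀ ε θ → SepLambda.SimpleOnRay B z₀ ε θ →
          SepLambda.ray z₀ θ ∩ frontier (SepLambda.pseudospectrum A ε) ∩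
            frontier (SepLambda.pseudospectrum B ε) = ∅ →
          DifferentiableAt ℝ (SepLambda.overlapLen A B z₀ ε) θ) ∧
      -- (v)
      (ε ≤ SepLambda.sepD A B ↔ volume (SepLambda.overlapSet A B z₀ ε) = 0) ∧
      -- (vii)
      (∃ v : ℝ, IsLeast (SepLambda.overlapLen A B z₀ ε '' Set.Ioc (-Real.pi) Real.pi) v ∧
        (v < 0 ↔ 0 < volume (SepLambda.overlapSet A B z₀ ε)) ∧
        (0 < volume (SepLambda.overlapSet A B z₀ ε) ↔ SepLambda.sepD A B < ε))) ∧
    -- (vi)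
    (∀ ε₁ ε₂ : ℝ, 0 ≤ ε₁ → 0 ≤ ε₂ →
      ((SepLambda.sepD A B < ε₁ ∧ ε₁ < ε₂ ∧
          volume (SepLambda.overlapSet A B z₀ ε₁) < ENNReal.ofReal (2 * Real.pi)) ↔
        (0 < volume (SepLambda.overlapSet A B z₀ ε₁) ∧
          volume (SepLambda.overlapSet A B z₀ ε₁) < volume (SepLambda.overlapSet A B z₀ ε₂))) ∧
      (SepLambda.sepD A B < ε₁ → ε₁ < ε₂ →
        0 < volume (SepLambda.overlapSet A B z₀ ε₁) ∧
          volume (SepLambda.overlapSet A B z₀ ε₁) ≤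
            volume (SepLambda.overlapSet A B z₀ ε₂))) := by
  refine ⟨fun ε hε => ⟨fun θ => SepLambda.overlapLen_neg_iff hε,
    fun θ => SepLambda.overlapLen_eq_zero_of_argMin_pos hε,
    SepLambda.continuous_overlapLen hε A B z₀,
    fun hzA hzB θ hA hB hd => SepLambda.differentiableAt_overlapLen hε hzA hzB hA hB hd,
    SepLambda.le_sepD_iff_volume_overlapSet_eq_zero hm hn hε, ?_⟩, fun ε₁ ε₂ h₁ h₂ => ⟨⟨?_, ?_⟩, ?_⟩⟩
  · obtain ⟨v, hv, hv'⟩ := SepLambda.exists_isLeast_overlapLen hε A B z₀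
    exact ⟨v, hv, hv', SepLambda.volume_overlapSet_pos_iff_sepD_lt hm hn hε⟩
  · rintro ⟨hsep, hlt, hvol⟩
    exact ⟨(SepLambda.volume_overlapSet_pos_iff_sepD_lt hm hn h₁).mpr hsep,
      SepLambda.volume_overlapSet_lt hm hn h₁ hsep hlt hvol⟩
  · rintro ⟨hpos, hlt⟩
    refine ⟨(SepLambda.volume_overlapSet_pos_iff_sepD_lt hm hn h₁).mp hpos, ?_,
      hlt.trans_le SepLambda.volume_overlapSet_le⟩
    by_contra hle
    exact hlt.not_ge (measure_mono (SepLambda.overlapSet_mono (not_lt.mp hle)))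
  · intro hsep hlt
    exact ⟨(SepLambda.volume_overlapSet_pos_iff_sepD_lt hm hn h₁).mpr hsep,
      measure_mono (SepLambda.overlapSet_mono hlt.le)⟩
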